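/- **Setting.** Let $L$ be a finite signature, $\mathbb A$ an $L$-structure, and $\mathbb B$ a substructure of $\mathbb A$ whose underlying set $B$ is definable in $\mathbb A$ (parameters allowed). Suppose $\mathbb A$ is finitely generated over $\mathbb B$, i.e. $\mathbb A$ is generated by $B$ and finitely many further elements. The list superstructure $\mathbb S=\mathbb S(\mathbb B,\mathbb N)$ is the structure with three sorts: $\mathbb B$, the set $\mathrm{List}(B)$ of nonempty finite tuples of elements of $B$, and $\langle\mathbb N;+,\cdot,0,1\rangle$; besides the operations and relations of $\mathbb B$ and of $\mathbb N$ it has the length function $\ell\colon\mathrm{List}(B)\to\mathbb N$ and the predicate $t(s,a,i)$ saying that $1\le i\le \ell(s)$ and $a$ is the $i$-th component of $s$. It is viewed as a one-sorted relational structure on the disjoint union of the sorts, with predicates for the sorts and for the graphs of the operations. An interpretation code $\Gamma$ consists of first-order formulas in the signature of $\mathbb S$ with a tuple $\bar y$ of parameter variables: a formula for a set of $n$-tuples, one for an equivalence relation on this set, and one for each symbol of $L$. For a structure $\mathcal M$ in the signature of $\mathbb S$ and a tuple $\bar q$ in $\mathcal M$, if the formulas define an equivalence relation on this set and the preimages of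 the graphs of the operations and relations of an $L$-structure on the quotient set, this $L$-structure is denoted $\Gamma(\mathcal M,\bar q)$. For a formula $\phi(\bar y)$, one says that $\mathbb A$ is regularly interpreted in $\mathbb S$ as $\Gamma(\mathbb S,\phi)$ if $\phi(\mathbb S)\neq\emptyset$ and $\Gamma(\mathbb S,\bar p)$ is an $L$-structure isomorphic to $\mathbb A$ for every $\bar p\in\phi(\mathbb S)$. One says that $\Gamma(\mathcal M,\phi)$ is well-defined if $\phi(\mathcal M)\ne\emptyset$, $\Gamma(\mathcal M,\bar q)$ is an $L$-structure for every $\bar q\in\phi(\mathcal M)$, and all these structures are isomorphic to each other. Suppose $\mathbb A$ is regularly interpreted in $\mathbb S$ in two ways, as $\Gamma_1(\mathbb S,\phi_1)$ and $\Gamma_2(\mathbb S,\phi_2)$. For $\bar p_i\in\phi_i(\mathbb S)$, a copy of $\mathbb B$ in $\Gamma_1(\mathbb S,\bar p_1)$ is the preimage $e^{-1}(B)$ under some isomorphism $e\colon\Gamma_1(\mathbb S,\bar p_1)\to\mathbb A$. For an isomorphism $\psi\colon\Gamma_1(\mathbb S,\bar p_1)\to\Gamma_2(\mathbb S,\bar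 p_2)$, its restriction to $e^{-1}(B)$ is said to be defined by a formula in $\mathbb S$ if that formula defines the set of all pairs of tuples $(\bar z_1,\bar z_2)$ with $[\bar z_1]\in e^{-1}(B)$ and $\psi([\bar z_1])=[\bar z_2]$. **Theorem (uniqueness of non-standard models).** Let $\mathcal M\equiv\mathbb S(\mathbb B,\mathbb N)$. 1. Suppose there is a formula $\theta(\bar z_1,\bar z_2,\bar y_1,\bar y_2,\bar u)$ such that for all $\bar p_1\in\phi_1(\mathbb S)$ and $\bar p_2\in\phi_2(\mathbb S)$ there are a tuple $\bar c$ in $\mathbb S$, a copy of $\mathbb B$ in $\Gamma_1(\mathbb S,\bar p_1)$, and an isomorphism $\Gamma_1(\mathbb S,\bar p_1)\to\Gamma_2(\mathbb S,\bar p_2)$ whose restriction to this copy is defined by $\theta(\bar z_1,\bar z_2,\bar p_1,\bar p_2,\bar c)$ in $\mathbb S$. Then $\Gamma_1(\mathcal M,\phi_1)$ and $\Gamma_2(\mathcal M,\phi_2)$ are well-defined and $\Gamma_1(\mathcal M,\phi_1)\cong\Gamma_2(\mathcal M,\phi_2)$, that is, $\Gamma_1(\mathcal M,\bar q_1)\cong\Gamma_2(\mathcal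 M,\bar q_2)$ for all $\bar q_1\in\phi_1(\mathcal M)$, $\bar q_2\in\phi_2(\mathcal M)$. 2. Suppose only that for some $\bar p_1\in\phi_1(\mathbb S)$ and $\bar p_2\in\phi_2(\mathbb S)$ there is an isomorphism $\Gamma_1(\mathbb S,\bar p_1)\to\Gamma_2(\mathbb S,\bar p_2)$ whose restriction to some copy of $\mathbb B$ in $\Gamma_1(\mathbb S,\bar p_1)$ is definable in $\mathbb S$ (with any parameters). Then there are $\bar q_1\in\phi_1(\mathcal M)$ and $\bar q_2\in\phi_2(\mathcal M)$ such that $\Gamma_1(\mathcal M,\bar q_1)$ and $\Gamma_2(\mathcal M,\bar q_2)$ are isomorphic $L$-structures. Consequently, if $\Gamma_1(\mathcal M,\phi_1)$ and $\Gamma_2(\mathcal M,\phi_2)$ are well-defined, then $\Gamma_1(\mathcal M,\phi_1)\cong\Gamma_2(\mathcal M,\phi_2)$, in the sense of item 1. -/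

import Mathlib

open FirstOrder FirstOrder.Language

universe u v u' v' w w'

/-! ### Interpretation codes -/

/-- A code for interpreting `L`-structures in `K`-structures: finitely many variables per point
(`dim`), finitely many parameters (`pdim`), and `K`-formulas for the domain, for the equivalence
relation, for the graph of every function symbol (constants are `0`-ary function symbols; the last
of the `m + 1` tuples is the value) and for every relation symbol of `L`. -/
structure InterpCode (L : FirstOrder.Language.{u, v}) (K : FirstOrder.Language.{u', v'}) where
  dim : ℕ
  pdim : ℕ
  dom : K.Formula (Fin dim ⊕ Fin pdim)
  eqv : K.Formula ((Fin 2 × Fin dim) ⊕ Fin pdim)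
  func : ∀ {m : ℕ}, L.Functions m → K.Formula ((Fin (m + 1) × Fin dim) ⊕ Fin pdim)
  rel : ∀ {m : ℕ}, L.Relations m → K.Formula ((Fin m × Fin dim) ⊕ Fin pdim)

namespace InterpCode

variable {L : FirstOrder.Language.{u, v}} {K : FirstOrder.Language.{u', v'}} (Γ : InterpCode L K)
  (M : Type w) [K.Structure M] (p : Fin Γ.pdim → M)

/-- `x` lies in the set defined by the domain formula with parameters `p`. -/
def InDom (x : Fin Γ.dim → M) : Prop := Γ.dom.Realize (Sum.elim x p)

/-- `x` and `y` satisfy the equivalence formula with parameters `p`. -/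
def Eqv (x y : Fin Γ.dim → M) : Prop := Γ.eqv.Realize (Sum.elim (fun i => ![x, y] i.1 i.2) p)

/-- The tuples `x 0, …, x (m - 1)` and the value `y` satisfy the formula for the graph of `f`. -/
def Graph {m : ℕ} (f : L.Functions m) (x : Fin m → Fin Γ.dim → M) (y : Fin Γ.dim → M) : Prop :=
  (Γ.func f).Realize
    (Sum.elim (fun i => (Fin.snoc x y : Fin (m + 1) → Fin Γ.dim → M) i.1 i.2) p)

/-- The tuples `x 0, …, x (m - 1)` satisfy the formula for the relation symbol `R`. -/
def Rel {m : ℕ} (R : L.Relations m) (x : Fin m → Fin Γ.dim → M) : Prop :=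
  (Γ.rel R).Realize (Sum.elim (fun i => x i.1 i.2) p)

/-- The admissibility conditions: with parameters `p`, the code does define an `L`-structure, that
is, `eqv` defines an equivalence relation on the set defined by `dom`, and the other formulas
define the preimages of graphs of functions, respectively of relations, on the quotient. -/
structure Admissible : Prop where
  eqv_dom : ∀ x y, Γ.Eqv M p x y → Γ.InDom M p x ∧ Γ.InDom M p y
  refl : ∀ x, Γ.InDom M p x → Γ.Eqv M p x x
  symm : ∀ x y, Γ.Eqv M p x y → Γ.Eqv M p y x
  trans : ∀ x y z, Γ.Eqv M p x y → Γ.Eqv M p y z → Γ.Eqv M p x z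
  graph_dom : ∀ {m : ℕ} (f : L.Functions m) x y, Γ.Graph M p f x y →
    (∀ i, Γ.InDom M p (x i)) ∧ Γ.InDom M p y
  graph_congr : ∀ {m : ℕ} (f : L.Functions m) x x' y y', (∀ i, Γ.Eqv M p (x i) (x' i)) →
    Γ.Eqv M p y y' → Γ.Graph M p f x y → Γ.Graph M p f x' y'
  graph_total : ∀ {m : ℕ} (f : L.Functions m) x, (∀ i, Γ.InDom M p (x i)) →
    ∃ y, Γ.Graph M p f x y
  graph_unique : ∀ {m : ℕ} (f : L.Functions m) x y y', Γ.Graph M p f x y → Γ.Graph M p f x y' →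
    Γ.Eqv M p y y'
  rel_dom : ∀ {m : ℕ} (R : L.Relations m) x, Γ.Rel M p R x → ∀ i, Γ.InDom M p (x i)
  rel_congr : ∀ {m : ℕ} (R : L.Relations m) x x', (∀ i, Γ.Eqv M p (x i) (x' i)) →
    Γ.Rel M p R x → Γ.Rel M p R x'

variable {Γ M p}

/-- The equivalence relation on the domain of the code. -/
def setoid (h : Γ.Admissible M p) : Setoid {x : Fin Γ.dim → M // Γ.InDom M p x} where
  r x y := Γ.Eqv M p x.1 y.1
  iseqv := ⟨fun x => h.refl x.1 x.2, fun hxy => h.symm _ _ hxy,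
    fun hxy hyz => h.trans _ _ _ hxy hyz⟩

/-- The underlying set of the `L`-structure `Γ(M, p)`. -/
def Str (h : Γ.Admissible M p) : Type w := Quotient (setoid h)

/-- The class of a tuple of the domain. -/
def cls (h : Γ.Admissible M p) (x : Fin Γ.dim → M) (hx : Γ.InDom M p x) : Str h :=
  Quotient.mk (setoid h) ⟨x, hx⟩

theorem exists_value (h : Γ.Admissible M p) {m : ℕ} (f : L.Functions m) (a : Fin m → Str h) :
    ∃ b : Str h, ∃ (x : Fin m → Fin Γ.dim → M) (hx : ∀ i, Γ.InDom M p (x i))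
      (y : Fin Γ.dim → M) (hy : Γ.InDom M p y),
      (∀ i, cls h (x i) (hx i) = a i) ∧ cls h y hy = b ∧ Γ.Graph M p f x y := by
  obtain ⟨y, hy⟩ := h.graph_total f (fun i => (a i).out.1) (fun i => (a i).out.2)
  exact ⟨cls h y (h.graph_dom f _ y hy).2, fun i => (a i).out.1, fun i => (a i).out.2, y, _,
    fun i => Quotient.out_eq (a i), rfl, hy⟩

/-- The `L`-structure `Γ(M, p)`. -/
noncomputable instance (h : Γ.Admissible M p) : L.Structure (Str h) where
  funMap f a := Classical.choose (exists_value h f a)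
  RelMap R a := ∃ (x : Fin _ → Fin Γ.dim → M) (hx : ∀ i, Γ.InDom M p (x i)),
    (∀ i, cls h (x i) (hx i) = a i) ∧ Γ.Rel M p R x

theorem cls_eq_iff (h : Γ.Admissible M p) (x y : Fin Γ.dim → M) (hx : Γ.InDom M p x)
    (hy : Γ.InDom M p y) : cls h x hx = cls h y hy ↔ Γ.Eqv M p x y :=
  ⟨fun e => Quotient.exact (s := setoid h) e, fun e => Quotient.sound (s := setoid h) e⟩

/-- The graph formula of `f` defines the preimage of the graph of `f` on `Γ(M, p)`. -/
theorem funMap_cls_iff (h : Γ.Admissible M p) {m : ℕ} (f : L.Functions m)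
    (x : Fin m → Fin Γ.dim → M) (hx : ∀ i, Γ.InDom M p (x i))
    (y : Fin Γ.dim → M) (hy : Γ.InDom M p y) :
    Structure.funMap f (fun i => cls h (x i) (hx i)) = cls h y hy ↔ Γ.Graph M p f x y := by
  obtain ⟨x', hx', y', hy', h1, h2, h3⟩ :=
    Classical.choose_spec (exists_value h f (fun i => cls h (x i) (hx i)))
  change Classical.choose (exists_value h f (fun i => cls h (x i) (hx i))) = _ ↔ _
  rw [← h2, cls_eq_iff]
  have hc : ∀ i, Γ.Eqv M p (x' i) (x i) := fun i => (cls_eq_iff h _ _ (hx' i) (hx i)).1 (h1 i)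
  have h4 : Γ.Graph M p f x y' := h.graph_congr f _ _ _ _ hc (h.refl y' hy') h3
  exact ⟨fun e => h.graph_congr f _ _ _ _ (fun i => h.refl _ (hx i)) e h4,
    fun e => h.graph_unique f x _ _ h4 e⟩

/-- The formula of `R` defines the preimage of the relation `R` on `Γ(M, p)`. -/
theorem relMap_cls_iff (h : Γ.Admissible M p) {m : ℕ} (R : L.Relations m)
    (x : Fin m → Fin Γ.dim → M) (hx : ∀ i, Γ.InDom M p (x i)) :
    Structure.RelMap R (fun i => cls h (x i) (hx i)) ↔ Γ.Rel M p R x := by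
  constructor
  · rintro ⟨x', hx', h1, h2⟩
    exact h.rel_congr R _ _ (fun i => (cls_eq_iff h _ _ (hx' i) (hx i)).1 (h1 i)) h2
  · exact fun e => ⟨x, hx, fun _ => rfl, e⟩

variable (Γ M)

/-- `(Γ, φ)` is a regular interpretation of `A` in `M`: there are parameters satisfying `φ`, and
for all of them `Γ(M, p)` is an `L`-structure isomorphic to `A`. -/
def IsRegularInterp (φ : K.Formula (Fin Γ.pdim)) (A : Type w') [L.Structure A] : Prop :=
  (∃ p : Fin Γ.pdim → M, φ.Realize p) ∧
    ∀ p : Fin Γ.pdim → M, φ.Realize p → ∃ h : Γ.Admissible M p, Nonempty (Str h ≃[L] A)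

/-- `Γ(M, φ)` is well-defined: there are parameters satisfying `φ`, for all of them `Γ(M, q)` is an
`L`-structure, and all these structures are isomorphic to each other. -/
def WellDefined (φ : K.Formula (Fin Γ.pdim)) : Prop :=
  (∃ q : Fin Γ.pdim → M, φ.Realize q) ∧
    (∀ q : Fin Γ.pdim → M, φ.Realize q → Γ.Admissible M q) ∧
    ∀ (q q' : Fin Γ.pdim → M) (h : Γ.Admissible M q) (h' : Γ.Admissible M q'),
      φ.Realize q → φ.Realize q' → Nonempty (Str h ≃[L] Str h')

variable {Γ M}

/-- Let `B` be a substructure of `A`, let the isomorphism `e : Γ₁(M, p₁) ≃ A` (induced by a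
coordinate map) determine the copy `e⁻¹(B)` of `B` in `Γ₁(M, p₁)`, and let
`ψ : Γ₁(M, p₁) ≃ Γ₂(M, p₂)`. This is the preimage in `M` of the graph of the restriction of `ψ` to
that copy of `B`. -/
def restrictedGraph {Γ₂ : InterpCode L K} {p₂ : Fin Γ₂.pdim → M} {A : Type w'} [L.Structure A]
    {h₁ : Γ.Admissible M p} {h₂ : Γ₂.Admissible M p₂} (B : L.Substructure A)
    (e : Str h₁ ≃[L] A) (ψ : Str h₁ ≃[L] Str h₂) : Set (Fin Γ.dim ⊕ Fin Γ₂.dim → M) :=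
  {z | ∃ (hx : Γ.InDom M p (z ∘ Sum.inl)) (hy : Γ₂.InDom M p₂ (z ∘ Sum.inr)),
    e (cls h₁ _ hx) ∈ B ∧ ψ (cls h₁ _ hx) = cls h₂ _ hy}

end InterpCode

/-! ### The list superstructure -/

/-- The relation symbols of the (one-sorted, relational) language of list superstructures of
`L`-structures: predicates for the three sorts, the relation symbols of `L`, symbols for the graphs
of the function symbols of `L`, symbols for `0`, `1` and the graphs of addition and multiplication
of the arithmetic, the predicate `t(s, a, i)` and the graph of the length function. -/
inductive ListRel (L : FirstOrder.Language.{u, v}) : ℕ → Type (max u v)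
  | isElem : ListRel L 1
  | isList : ListRel L 1
  | isNum : ListRel L 1
  | rel {m : ℕ} (R : L.Relations m) : ListRel L m
  | graph {m : ℕ} (f : L.Functions m) : ListRel L (m + 1)
  | zero : ListRel L 1
  | one : ListRel L 1
  | add : ListRel L 3
  | mul : ListRel L 3
  | comp : ListRel L 3
  | len : ListRel L 2

/-- The language of list superstructures of `L`-structures. -/
def listLang (L : FirstOrder.Language.{u, v}) : FirstOrder.Language.{0, max u v} := ⟨fun _ => Empty, ListRel L⟩

/-- The universe of the list superstructure of `B`: the disjoint union of `B`, of the set of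
nonempty finite lists of elements of `B`, and of the set of natural numbers. -/
inductive ListSuper (B : Type w) : Type w
  | elem (b : B) : ListSuper B
  | list (s : {l : List B // l ≠ []}) : ListSuper B
  | num (n : ℕ) : ListSuper B

/-- Interpretation of the symbols in the list superstructure. -/
def ListSuper.holds {L : FirstOrder.Language.{u, v}} {B : Type w} [L.Structure B] :
    {n : ℕ} → ListRel L n → (Fin n → ListSuper B) → Prop
  | _, .isElem, x => ∃ b, x 0 = .elem b
  | _, .isList, x => ∃ s, x 0 = .list s
  | _, .isNum, x => ∃ n, x 0 = .num n
  | _, .rel R, x => ∃ b : Fin _ → B, (∀ i, x i = .elem (b i)) ∧ Structure.RelMap R b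
  | _, .graph f, x => ∃ b : Fin _ → B, (∀ i, x (Fin.castSucc i) = .elem (b i)) ∧
      x (Fin.last _) = .elem (Structure.funMap f b)
  | _, .zero, x => x 0 = .num 0
  | _, .one, x => x 0 = .num 1
  | _, .add, x => ∃ a b : ℕ, x 0 = .num a ∧ x 1 = .num b ∧ x 2 = .num (a + b)
  | _, .mul, x => ∃ a b : ℕ, x 0 = .num a ∧ x 1 = .num b ∧ x 2 = .num (a * b)
  | _, .comp, x => ∃ (s : {l : List B // l ≠ []}) (a : B) (i : ℕ),
      x 0 = .list s ∧ x 1 = .elem a ∧ x 2 = .num i ∧ 1 ≤ i ∧ s.1[i - 1]? = some a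
  | _, .len, x => ∃ s : {l : List B // l ≠ []}, x 0 = .list s ∧ x 1 = .num s.1.length

/-- The list superstructure of the `L`-structure `B`. -/
instance (L : FirstOrder.Language.{u, v}) (B : Type w) [L.Structure B] :
    (listLang L).Structure (ListSuper B) where
  funMap f := Empty.elim f
  RelMap R x := ListSuper.holds R x

/-! ### Conditions expressed by the same formula in two structures -/

/-- One and the same formula expresses the condition `P` in `M` and the condition `Q` in `N`. -/
def JointlyDefinable (K : FirstOrder.Language.{u', v'}) {M : Type w} {N : Type w'} [K.Structure M]
    [K.Structure N] {α : Type} (P : (α → M) → Prop) (Q : (α → N) → Prop) : Prop :=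
  ∃ φ : K.Formula α, (∀ v, φ.Realize v ↔ P v) ∧ ∀ v, φ.Realize v ↔ Q v

namespace JointlyDefinable

variable {K : FirstOrder.Language.{u', v'}} {M : Type w} {N : Type w'} [K.Structure M]
    [K.Structure N] {α β β' : Type} {P P' : (α → M) → Prop} {Q Q' : (α → N) → Prop}

theorem of_iff (h : JointlyDefinable K P Q) (hP : ∀ v, P v ↔ P' v) (hQ : ∀ v, Q v ↔ Q' v) :
    JointlyDefinable K P' Q' := by
  obtain ⟨φ, h₁, h₂⟩ := h
  exact ⟨φ, fun v => (h₁ v).trans (hP v), fun v => (h₂ v).trans (hQ v)⟩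

theorem realize (φ : K.Formula β) (g : β → α) :
    JointlyDefinable K (fun v : α → M => φ.Realize fun b => v (g b))
      (fun v : α → N => φ.Realize fun b => v (g b)) :=
  ⟨φ.relabel g, fun _ => Formula.realize_relabel, fun _ => Formula.realize_relabel⟩

theorem and (h : JointlyDefinable K P Q) (h' : JointlyDefinable K P' Q') :
    JointlyDefinable K (fun v => P v ∧ P' v) (fun v => Q v ∧ Q' v) := by
  obtain ⟨φ, h₁, h₂⟩ := h
  obtain ⟨ψ, h₃, h₄⟩ := h'
  exact ⟨φ ⊓ ψ, fun v => by rw [Formula.realize_inf, h₁, h₃],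
    fun v => by rw [Formula.realize_inf, h₂, h₄]⟩

theorem imp (h : JointlyDefinable K P Q) (h' : JointlyDefinable K P' Q') :
    JointlyDefinable K (fun v => P v → P' v) (fun v => Q v → Q' v) := by
  obtain ⟨φ, h₁, h₂⟩ := h
  obtain ⟨ψ, h₃, h₄⟩ := h'
  exact ⟨φ.imp ψ, fun v => by rw [Formula.realize_imp, h₁, h₃],
    fun v => by rw [Formula.realize_imp, h₂, h₄]⟩

theorem iff (h : JointlyDefinable K P Q) (h' : JointlyDefinable K P' Q') :
    JointlyDefinable K (fun v => P v ↔ P' v) (fun v => Q v ↔ Q' v) :=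
  ((h.imp h').and (h'.imp h)).of_iff (fun _ => iff_def.symm) (fun _ => iff_def.symm)

theorem forall_finite {ι : Type*} [Finite ι] {P : ι → (α → M) → Prop} {Q : ι → (α → N) → Prop}
    (h : ∀ i, JointlyDefinable K (P i) (Q i)) :
    JointlyDefinable K (fun v => ∀ i, P i v) (fun v => ∀ i, Q i v) := by
  choose φ h₁ h₂ using h
  exact ⟨Formula.iInf φ, fun v => by simp only [Formula.realize_iInf, h₁],
    fun v => by simp only [Formula.realize_iInf, h₂]⟩

theorem ex [Finite β] {P : (α → M) → (β → M) → Prop} {Q : (α → N) → (β → N) → Prop}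
    (h : JointlyDefinable K (fun v : α ⊕ β → M => P (fun a => v (.inl a)) fun b => v (.inr b))
      (fun v : α ⊕ β → N => Q (fun a => v (.inl a)) fun b => v (.inr b))) :
    JointlyDefinable K (fun v => ∃ x, P v x) (fun v => ∃ x, Q v x) := by
  obtain ⟨φ, h₁, h₂⟩ := h
  exact ⟨φ.iExs β, fun v => by simp only [Formula.realize_iExs, h₁, Sum.elim_inl, Sum.elim_inr],
    fun v => by simp only [Formula.realize_iExs, h₂, Sum.elim_inl, Sum.elim_inr]⟩

theorem all [Finite β] {P : (α → M) → (β → M) → Prop} {Q : (α → N) → (β → N) → Prop}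
    (h : JointlyDefinable K (fun v : α ⊕ β → M => P (fun a => v (.inl a)) fun b => v (.inr b))
      (fun v : α ⊕ β → N => Q (fun a => v (.inl a)) fun b => v (.inr b))) :
    JointlyDefinable K (fun v => ∀ x, P v x) (fun v => ∀ x, Q v x) := by
  obtain ⟨φ, h₁, h₂⟩ := h
  exact ⟨φ.iAlls β, fun v => by simp only [Formula.realize_iAlls, h₁, Sum.elim_inl, Sum.elim_inr],
    fun v => by simp only [Formula.realize_iAlls, h₂, Sum.elim_inl, Sum.elim_inr]⟩

theorem all_family [Finite β] [Finite β'] {P : (α → M) → (β → β' → M) → Prop}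
    {Q : (α → N) → (β → β' → N) → Prop}
    (h : JointlyDefinable K
      (fun v : α ⊕ (β × β') → M => P (fun a => v (.inl a)) fun b b' => v (.inr (b, b')))
      (fun v : α ⊕ (β × β') → N => Q (fun a => v (.inl a)) fun b b' => v (.inr (b, b')))) :
    JointlyDefinable K (fun v => ∀ x, P v x) (fun v => ∀ x, Q v x) := by
  refine (all (P := fun v x => P v fun b b' => x (b, b'))
    (Q := fun v x => Q v fun b b' => x (b, b')) h).of_iff (fun v => ?_) (fun v => ?_) <;>
  exact ⟨fun h x => h fun b => x b.1 b.2, fun h x => h _⟩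

theorem transfer (hMN : K.ElementarilyEquivalent M N) {p : Prop} {q : Prop}
    (h : JointlyDefinable K (fun _ : Empty → M => p) (fun _ : Empty → N => q)) : p ↔ q := by
  obtain ⟨φ, h₁, h₂⟩ := h
  exact (h₁ default).symm.trans ((elementarilyEquivalent_iff.1 hMN φ).trans (h₂ default))

end JointlyDefinable

namespace InterpCode

variable {L : FirstOrder.Language.{u, v}} {K : FirstOrder.Language.{u', v'}}
  (Γ Γ₁ Γ₂ : InterpCode L K) {M : Type w} {N : Type w'} [K.Structure M] [K.Structure N] {α : Type}

open JointlyDefinable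

theorem jointlyDefinable_inDom (p : Fin Γ.pdim → α) (x : Fin Γ.dim → α) :
    JointlyDefinable K (fun v : α → M => Γ.InDom M (fun i => v (p i)) fun i => v (x i))
      (fun v : α → N => Γ.InDom N (fun i => v (p i)) fun i => v (x i)) := by
  refine (realize Γ.dom (Sum.elim x p)).of_iff (fun v => ?_) (fun v => ?_) <;>
  · refine iff_of_eq (congrArg Γ.dom.Realize ?_)
    ext (i | i) <;> rfl

theorem jointlyDefinable_eqv (p : Fin Γ.pdim → α) (x y : Fin Γ.dim → α) :
    JointlyDefinable K
      (fun v : α → M => Γ.Eqv M (fun i => v (p i)) (fun i => v (x i)) fun i => v (y i))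
      (fun v : α → N => Γ.Eqv N (fun i => v (p i)) (fun i => v (x i)) fun i => v (y i)) := by
  refine (realize Γ.eqv (Sum.elim (fun i => ![x, y] i.1 i.2) p)).of_iff
    (fun v => ?_) (fun v => ?_) <;>
  · refine iff_of_eq (congrArg Γ.eqv.Realize ?_)
    ext (⟨i, j⟩ | i)
    · fin_cases i <;> rfl
    · rfl

theorem jointlyDefinable_graph {m : ℕ} (f : L.Functions m) (p : Fin Γ.pdim → α)
    (x : Fin m → Fin Γ.dim → α) (y : Fin Γ.dim → α) :
    JointlyDefinable K
      (fun v : α → M => Γ.Graph M (fun i => v (p i)) f (fun i j => v (x i j)) fun i => v (y i))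
      (fun v : α → N => Γ.Graph N (fun i => v (p i)) f (fun i j => v (x i j)) fun i => v (y i)) := by
  refine (realize (Γ.func f)
    (Sum.elim (fun i => (Fin.snoc x y : Fin (m + 1) → Fin Γ.dim → α) i.1 i.2) p)).of_iff
    (fun v => ?_) (fun v => ?_) <;>
  · refine iff_of_eq (congrArg (Γ.func f).Realize ?_)
    ext (⟨i, j⟩ | i)
    · induction i using Fin.lastCases <;> simp
    · rfl

theorem jointlyDefinable_rel {m : ℕ} (R : L.Relations m) (p : Fin Γ.pdim → α)
    (x : Fin m → Fin Γ.dim → α) :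
    JointlyDefinable K (fun v : α → M => Γ.Rel M (fun i => v (p i)) R fun i j => v (x i j))
      (fun v : α → N => Γ.Rel N (fun i => v (p i)) R fun i j => v (x i j)) := by
  refine (realize (Γ.rel R) (Sum.elim (fun i => x i.1 i.2) p)).of_iff
    (fun v => ?_) (fun v => ?_) <;>
  · refine iff_of_eq (congrArg (Γ.rel R).Realize ?_)
    ext (i | i) <;> rfl

theorem admissible_iff (p : Fin Γ.pdim → M) : Γ.Admissible M p ↔
    (∀ x y, Γ.Eqv M p x y → Γ.InDom M p x ∧ Γ.InDom M p y) ∧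
    (∀ x, Γ.InDom M p x → Γ.Eqv M p x x) ∧
    (∀ x y, Γ.Eqv M p x y → Γ.Eqv M p y x) ∧
    (∀ x y z, Γ.Eqv M p x y → Γ.Eqv M p y z → Γ.Eqv M p x z) ∧
    (∀ (f : Σ m, L.Functions m) x y, Γ.Graph M p f.2 x y →
      (∀ i, Γ.InDom M p (x i)) ∧ Γ.InDom M p y) ∧
    (∀ (f : Σ m, L.Functions m) x x' y y', (∀ i, Γ.Eqv M p (x i) (x' i)) →
      Γ.Eqv M p y y' → Γ.Graph M p f.2 x y → Γ.Graph M p f.2 x' y') ∧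
    (∀ (f : Σ m, L.Functions m) x, (∀ i, Γ.InDom M p (x i)) → ∃ y, Γ.Graph M p f.2 x y) ∧
    (∀ (f : Σ m, L.Functions m) x y y', Γ.Graph M p f.2 x y → Γ.Graph M p f.2 x y' →
      Γ.Eqv M p y y') ∧
    (∀ (R : Σ m, L.Relations m) x, Γ.Rel M p R.2 x → ∀ i, Γ.InDom M p (x i)) ∧
    (∀ (R : Σ m, L.Relations m) x x', (∀ i, Γ.Eqv M p (x i) (x' i)) →
      Γ.Rel M p R.2 x → Γ.Rel M p R.2 x') :=
  ⟨fun h => ⟨h.1, h.2, h.3, h.4, fun f => h.5 f.2, fun f => h.6 f.2, fun f => h.7 f.2,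
      fun f => h.8 f.2, fun R => h.9 R.2, fun R => h.10 R.2⟩,
    fun ⟨h1, h2, h3, h4, h5, h6, h7, h8, h9, h10⟩ => ⟨h1, h2, h3, h4, fun f => h5 ⟨_, f⟩,
      fun f => h6 ⟨_, f⟩, fun f => h7 ⟨_, f⟩, fun f => h8 ⟨_, f⟩, fun R => h9 ⟨_, R⟩,
      fun R => h10 ⟨_, R⟩⟩⟩

theorem finite_functions [Finite L.Symbols] : Finite (Σ m, L.Functions m) :=
  Finite.of_injective (fun f => (Sum.inl f : L.Symbols)) Sum.inl_injective

theorem finite_relations [Finite L.Symbols] : Finite (Σ m, L.Relations m) :=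
  Finite.of_injective (fun f => (Sum.inr f : L.Symbols)) Sum.inr_injective

theorem jointlyDefinable_admissible [Finite L.Symbols] (p : Fin Γ.pdim → α) :
    JointlyDefinable K (fun v : α → M => Γ.Admissible M fun i => v (p i))
      (fun v : α → N => Γ.Admissible N fun i => v (p i)) := by
  have := finite_functions (L := L)
  have := finite_relations (L := L)
  simp only [admissible_iff]
  refine and ?_ <| and ?_ <| and ?_ <| and ?_ <| and ?_ <| and ?_ <| and ?_ <| and ?_ <| and ?_ ?_
  · exact all <| all <| (Γ.jointlyDefinable_eqv _ _ _).imp <|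
      (Γ.jointlyDefinable_inDom _ _).and (Γ.jointlyDefinable_inDom _ _)
  · exact all <| (Γ.jointlyDefinable_inDom _ _).imp (Γ.jointlyDefinable_eqv _ _ _)
  · exact all <| all <| (Γ.jointlyDefinable_eqv _ _ _).imp (Γ.jointlyDefinable_eqv _ _ _)
  · exact all <| all <| all <| (Γ.jointlyDefinable_eqv _ _ _).imp <|
      (Γ.jointlyDefinable_eqv _ _ _).imp (Γ.jointlyDefinable_eqv _ _ _)
  · exact forall_finite fun f => all_family <| all <| (Γ.jointlyDefinable_graph _ _ _ _).imp <|
      (forall_finite fun _ => Γ.jointlyDefinable_inDom _ _).and (Γ.jointlyDefinable_inDom _ _)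
  · exact forall_finite fun f => all_family <| all_family <| all <| all <|
      (forall_finite fun _ => Γ.jointlyDefinable_eqv _ _ _).imp <|
      (Γ.jointlyDefinable_eqv _ _ _).imp <| (Γ.jointlyDefinable_graph _ _ _ _).imp <|
      Γ.jointlyDefinable_graph _ _ _ _
  · exact forall_finite fun f => all_family <|
      (forall_finite fun _ => Γ.jointlyDefinable_inDom _ _).imp <| ex <|
      Γ.jointlyDefinable_graph _ _ _ _
  · exact forall_finite fun f => all_family <| all <| all <|
      (Γ.jointlyDefinable_graph _ _ _ _).imp <| (Γ.jointlyDefinable_graph _ _ _ _).imp <|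
      Γ.jointlyDefinable_eqv _ _ _
  · exact forall_finite fun f => all_family <| (Γ.jointlyDefinable_rel _ _ _).imp <|
      forall_finite fun _ => Γ.jointlyDefinable_inDom _ _
  · exact forall_finite fun f => all_family <| all_family <|
      (forall_finite fun _ => Γ.jointlyDefinable_eqv _ _ _).imp <|
      (Γ.jointlyDefinable_rel _ _ _).imp <| Γ.jointlyDefinable_rel _ _ _

/-- The conditions on a relation `T` between tuples to be the preimage of the graph of an
isomorphism from `Γ₁(M, p₁)` to `Γ₂(M, p₂)`. -/
def IsIsoGraph (p₁ : Fin Γ₁.pdim → M) (p₂ : Fin Γ₂.pdim → M)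
    (T : (Fin Γ₁.dim → M) → (Fin Γ₂.dim → M) → Prop) : Prop :=
  (∀ x y, T x y → Γ₁.InDom M p₁ x ∧ Γ₂.InDom M p₂ y) ∧
  (∀ x, Γ₁.InDom M p₁ x → ∃ y, T x y) ∧
  (∀ y, Γ₂.InDom M p₂ y → ∃ x, T x y) ∧
  (∀ x x' y y', T x y → T x' y' → (Γ₁.Eqv M p₁ x x' ↔ Γ₂.Eqv M p₂ y y')) ∧
  (∀ (f : Σ m, L.Functions m) x x' y y', (∀ i, T (x i) (y i)) → T x' y' →
    (Γ₁.Graph M p₁ f.2 x x' ↔ Γ₂.Graph M p₂ f.2 y y')) ∧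
  (∀ (R : Σ m, L.Relations m) x y, (∀ i, T (x i) (y i)) →
    (Γ₁.Rel M p₁ R.2 x ↔ Γ₂.Rel M p₂ R.2 y))

theorem jointlyDefinable_isIsoGraph [Finite L.Symbols] {γ : Type}
    (σ : K.Formula ((Fin Γ₁.dim ⊕ Fin Γ₂.dim) ⊕ γ)) (p₁ : Fin Γ₁.pdim → α) (p₂ : Fin Γ₂.pdim → α)
    (c : γ → α) :
    JointlyDefinable K
      (fun v : α → M => IsIsoGraph Γ₁ Γ₂ (fun i => v (p₁ i)) (fun i => v (p₂ i))
        fun x y => σ.Realize (Sum.elim (Sum.elim x y) fun i => v (c i)))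
      (fun v : α → N => IsIsoGraph Γ₁ Γ₂ (fun i => v (p₁ i)) (fun i => v (p₂ i))
        fun x y => σ.Realize (Sum.elim (Sum.elim x y) fun i => v (c i))) := by
  have := finite_functions (L := L)
  have := finite_relations (L := L)
  have hσ {α : Type} (x : Fin Γ₁.dim → α) (y : Fin Γ₂.dim → α) (c : γ → α) :
      JointlyDefinable K
      (fun v : α → M => σ.Realize
        (Sum.elim (Sum.elim (fun i => v (x i)) fun i => v (y i)) fun i => v (c i)))
      (fun v : α → N => σ.Realize
        (Sum.elim (Sum.elim (fun i => v (x i)) fun i => v (y i)) fun i => v (c i))) := by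
    refine (realize σ (Sum.elim (Sum.elim x y) c)).of_iff (fun v => ?_) (fun v => ?_) <;>
    · refine iff_of_eq (congrArg σ.Realize ?_)
      ext ((i | i) | i) <;> rfl
  unfold IsIsoGraph
  refine and ?_ <| and ?_ <| and ?_ <| and ?_ <| and ?_ ?_
  · exact all <| all <| (hσ _ _ _).imp <|
      (Γ₁.jointlyDefinable_inDom _ _).and (Γ₂.jointlyDefinable_inDom _ _)
  · exact all <| (Γ₁.jointlyDefinable_inDom _ _).imp <| ex <| hσ _ _ _
  · exact all <| (Γ₂.jointlyDefinable_inDom _ _).imp <| ex <| hσ _ _ _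
  · exact all <| all <| all <| all <| (hσ _ _ _).imp <| (hσ _ _ _).imp <|
      (Γ₁.jointlyDefinable_eqv _ _ _).iff (Γ₂.jointlyDefinable_eqv _ _ _)
  · exact forall_finite fun f => all_family <| all <| all_family <| all <|
      (forall_finite fun _ => hσ _ _ _).imp <| (hσ _ _ _).imp <|
      (Γ₁.jointlyDefinable_graph _ _ _ _).iff (Γ₂.jointlyDefinable_graph _ _ _ _)
  · exact forall_finite fun f => all_family <| all_family <|
      (forall_finite fun _ => hσ _ _ _).imp <|
      (Γ₁.jointlyDefinable_rel _ _ _).iff (Γ₂.jointlyDefinable_rel _ _ _)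

variable {Γ Γ₁ Γ₂}

theorem exists_cls {p : Fin Γ.pdim → M} {h : Γ.Admissible M p} (a : Str h) :
    ∃ x hx, cls h x hx = a :=
  ⟨(Quotient.out a).1, (Quotient.out a).2, Quotient.out_eq a⟩

theorem exists_cls_family {p : Fin Γ.pdim → M} {h : Γ.Admissible M p} {ι : Type*}
    (a : ι → Str h) : ∃ (x : ι → Fin Γ.dim → M) (hx : ∀ i, Γ.InDom M p (x i)),
      (fun i => cls h (x i) (hx i)) = a := by
  choose x hx h using fun i => exists_cls (a i)
  exact ⟨x, hx, funext h⟩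

variable {p₁ : Fin Γ₁.pdim → M} {p₂ : Fin Γ₂.pdim → M} {h₁ : Γ₁.Admissible M p₁}
  {h₂ : Γ₂.Admissible M p₂}

theorem isIsoGraph_of_equiv (ψ : Str h₁ ≃[L] Str h₂) :
    IsIsoGraph Γ₁ Γ₂ p₁ p₂ fun x y => ∃ hx hy, ψ (cls h₁ x hx) = cls h₂ y hy := by
  refine ⟨fun x y ⟨hx, hy, _⟩ => ⟨hx, hy⟩, fun x hx => ?_, fun y hy => ?_, ?_, ?_, ?_⟩
  · obtain ⟨y, hy, e⟩ := exists_cls (ψ (cls h₁ x hx))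
    exact ⟨y, hx, hy, e.symm⟩
  · obtain ⟨x, hx, e⟩ := exists_cls (ψ.symm (cls h₂ y hy))
    exact ⟨x, hx, hy, by rw [e, FirstOrder.Language.Equiv.apply_symm_apply]⟩
  · rintro x x' y y' ⟨hx, hy, e⟩ ⟨hx', hy', e'⟩
    rw [← cls_eq_iff h₁ _ _ hx hx', ← cls_eq_iff h₂ _ _ hy hy', ← e, ← e', ψ.injective.eq_iff]
  · rintro ⟨m, f⟩ x x' y y' h ⟨hx', hy', e'⟩
    choose hx hy e using h
    rw [← funMap_cls_iff h₁ f x hx x' hx', ← funMap_cls_iff h₂ f y hy y' hy', ← e',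
      ← funext e, ← ψ.injective.eq_iff, ψ.map_fun]
    rfl
  · rintro ⟨m, R⟩ x y h
    choose hx hy e using h
    rw [← relMap_cls_iff h₁ R x hx, ← relMap_cls_iff h₂ R y hy, ← funext e, ← ψ.map_rel]
    rfl

theorem IsIsoGraph.nonempty_equiv {T : (Fin Γ₁.dim → M) → (Fin Γ₂.dim → M) → Prop}
    (hT : IsIsoGraph Γ₁ Γ₂ p₁ p₂ T) (h₁ : Γ₁.Admissible M p₁) (h₂ : Γ₂.Admissible M p₂) :
    Nonempty (Str h₁ ≃[L] Str h₂) := by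
  obtain ⟨hdom, htot, hsurj, heqv, hfun, hrel⟩ := hT
  have key (a : Str h₁) : ∃ b : Str h₂, ∃ x y hx hy, T x y ∧ cls h₁ x hx = a ∧ cls h₂ y hy = b := by
    obtain ⟨x, hx, rfl⟩ := exists_cls a
    obtain ⟨y, hxy⟩ := htot x hx
    exact ⟨_, x, y, hx, (hdom x y hxy).2, hxy, rfl, rfl⟩
  choose g x y hx hy hxy hxa hyb using key
  have hg {x y} (h : T x y) : g (cls h₁ x (hdom x y h).1) = cls h₂ y (hdom x y h).2 := by
    rw [← hyb, cls_eq_iff, ← heqv _ _ _ _ (hxy _) h, ← cls_eq_iff h₁ _ _ (hx _) (hdom x y h).1, hxa]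
  have hinj : Function.Injective g := fun a b e => by
    rw [← hxa a, ← hxa b, cls_eq_iff, heqv _ _ _ _ (hxy _) (hxy _), ← cls_eq_iff h₂ _ _ (hy _) (hy _),
      hyb, hyb, e]
  have hsur : Function.Surjective g := fun b => by
    obtain ⟨y, hy, rfl⟩ := exists_cls b
    obtain ⟨x, h⟩ := hsurj y hy
    exact ⟨_, hg h⟩
  refine ⟨⟨Equiv.ofBijective g ⟨hinj, hsur⟩, fun {m} f a => ?_, fun {m} R a => ?_⟩⟩
  · change g _ = Structure.funMap f fun i => g (a i)
    have e : Structure.funMap f a = Structure.funMap f fun i => cls h₁ _ (hx (a i)) := by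
      simp only [hxa]
    rw [← hyb (Structure.funMap f a), ← funext fun i => hyb (a i), eq_comm, funMap_cls_iff,
      ← hfun ⟨m, f⟩ _ _ _ _ (fun i => hxy (a i)) (hxy _), ← funMap_cls_iff h₁ f _
        (fun i => hx (a i)) _ (hx _), hxa, e]
  · change Structure.RelMap R (fun i => g (a i)) ↔ _
    rw [← funext fun i => hyb (a i), relMap_cls_iff, ← hrel ⟨m, R⟩ _ _ (fun i => hxy (a i)),
      ← relMap_cls_iff h₁ R _ (fun i => hx (a i)), funext fun i => hxa (a i)]

end InterpCode

/-! ### Definability along an assignment of variables -/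

/-- The condition `P` on the points of `X` is defined by a formula, where a point `c` determines the
values `e c` of the variables. -/
def DefinableAlong (K : FirstOrder.Language.{u', v'}) {N : Type w} [K.Structure N] {X : Type*}
    {α : Type} (e : X → α → N) (P : X → Prop) : Prop :=
  ∃ φ : K.Formula α, ∀ c, φ.Realize (e c) ↔ P c

/-- The assignment on `X × Y` that combines an assignment on `X` with new variables on `Y`. -/
def extendAssignment {N : Type w} {X Y : Type*} {α β : Type} (e : X → α → N) (f : Y → β → N)
    (c : X × Y) : α ⊕ β → N :=
  Sum.elim (e c.1) (f c.2)

/-- The function `g` is the value of one of the variables of the assignment `e`. -/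
def IsVariable {N : Type w} {X : Type*} {α : Type} (e : X → α → N) (g : X → N) : Prop :=
  ∃ a, ∀ c, e c a = g c

namespace DefinableAlong

variable {K : FirstOrder.Language.{u', v'}} {N : Type w} [K.Structure N] {X : Type*}
    {α β : Type} {e : X → α → N} {P Q : X → Prop}

theorem of_iff (h : DefinableAlong K e P) (hP : ∀ c, P c ↔ Q c) : DefinableAlong K e Q := by
  obtain ⟨φ, h⟩ := h
  exact ⟨φ, fun c => (h c).trans (hP c)⟩

theorem realize (φ : K.Formula β) {g : X → β → N} (hg : ∀ b, IsVariable e fun c => g c b) :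
    DefinableAlong K e fun c => φ.Realize (g c) := by
  choose a ha using hg
  refine ⟨φ.relabel a, fun c => Formula.realize_relabel.trans (iff_of_eq (congrArg φ.Realize ?_))⟩
  ext b
  exact ha b c

theorem relMap {n : ℕ} (R : K.Relations n) {g : X → Fin n → N}
    (hg : ∀ b, IsVariable e fun c => g c b) :
    DefinableAlong K e fun c => Structure.RelMap R (g c) :=
  (realize (R.formula Term.var) hg).of_iff fun _ => Formula.realize_rel

theorem eq {f g : X → N} (hf : IsVariable e f) (hg : IsVariable e g) :
    DefinableAlong K e fun c => f c = g c := by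
  obtain ⟨a, ha⟩ := hf
  obtain ⟨b, hb⟩ := hg
  exact ⟨Term.equal (Term.var a) (Term.var b), fun c => by
    rw [Formula.realize_equal, Term.realize_var, Term.realize_var, ha, hb]⟩

theorem and (hP : DefinableAlong K e P) (hQ : DefinableAlong K e Q) :
    DefinableAlong K e fun c => P c ∧ Q c := by
  obtain ⟨φ, h⟩ := hP
  obtain ⟨ψ, h'⟩ := hQ
  exact ⟨φ ⊓ ψ, fun c => by rw [Formula.realize_inf, h, h']⟩

theorem or (hP : DefinableAlong K e P) (hQ : DefinableAlong K e Q) :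
    DefinableAlong K e fun c => P c ∨ Q c := by
  obtain ⟨φ, h⟩ := hP
  obtain ⟨ψ, h'⟩ := hQ
  exact ⟨φ ⊔ ψ, fun c => by rw [Formula.realize_sup, h, h']⟩

theorem not (hP : DefinableAlong K e P) : DefinableAlong K e fun c => ¬ P c := by
  obtain ⟨φ, h⟩ := hP
  exact ⟨φ.not, fun c => by rw [Formula.realize_not, h]⟩

theorem imp (hP : DefinableAlong K e P) (hQ : DefinableAlong K e Q) :
    DefinableAlong K e fun c => P c → Q c :=
  (hP.not.or hQ).of_iff fun _ => imp_iff_not_or.symm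

theorem forall_finite {ι : Type*} [Finite ι] {P : ι → X → Prop}
    (h : ∀ i, DefinableAlong K e (P i)) : DefinableAlong K e fun c => ∀ i, P i c := by
  choose φ h using h
  exact ⟨Formula.iInf φ, fun c => by simp only [Formula.realize_iInf, h]⟩

theorem exists_finite {ι : Type*} [Finite ι] {P : ι → X → Prop}
    (h : ∀ i, DefinableAlong K e (P i)) : DefinableAlong K e fun c => ∃ i, P i c := by
  choose φ h using h
  exact ⟨Formula.iSup φ, fun c => by simp only [Formula.realize_iSup, h]⟩

theorem ex_tuple [Finite β] {P : X → (β → N) → Prop}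
    (h : DefinableAlong K (extendAssignment e id) fun c => P c.1 c.2) :
    DefinableAlong K e fun c => ∃ x, P c x := by
  obtain ⟨φ, h⟩ := h
  exact ⟨φ.iExs β, fun c => Formula.realize_iExs.trans (exists_congr fun x => h (c, x))⟩

theorem ex {P : X → N → Prop}
    (h : DefinableAlong K (extendAssignment e (Function.const Unit))
      fun c => P c.1 c.2) :
    DefinableAlong K e fun c => ∃ x, P c x := by
  obtain ⟨φ, h⟩ := h
  exact ⟨φ.iExs Unit, fun c => Formula.realize_iExs.trans
    ⟨fun ⟨x, hx⟩ => ⟨x (), (h (c, x ())).1 hx⟩, fun ⟨x, hx⟩ => ⟨fun _ => x, (h (c, x)).2 hx⟩⟩⟩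

theorem all_tuple [Finite β] {P : X → (β → N) → Prop}
    (h : DefinableAlong K (extendAssignment e id) fun c => P c.1 c.2) :
    DefinableAlong K e fun c => ∀ x, P c x :=
  (ex_tuple (P := fun c x => ¬ P c x) h.not).not.of_iff fun _ => not_exists_not

end DefinableAlong

namespace IsVariable

variable {N : Type w} {X Y : Type*} {α β : Type} {e : X → α → N}

theorem weaken {g : X → N} (hg : IsVariable e g) {f : Y → β → N} :
    IsVariable (extendAssignment e f) fun c => g c.1 := by
  obtain ⟨a, h⟩ := hg
  exact ⟨.inl a, fun c => h c.1⟩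

theorem new : IsVariable (extendAssignment e (Function.const Unit)) fun c => c.2 :=
  ⟨.inr (), fun _ => rfl⟩

theorem new_tuple (b : β) : IsVariable (extendAssignment e id) fun c => c.2 b :=
  ⟨.inr b, fun _ => rfl⟩

end IsVariable

/-! ### Arithmetic in the list superstructure -/

namespace ListSuper

variable {L : FirstOrder.Language.{u, v}} {B : Type w} [L.Structure B] {X : Type*} {α β : Type}
  {e : X → α → ListSuper B}

open DefinableAlong

/-- One new variable, for a number. -/
def natVar (n : ℕ) (_ : Unit) : ListSuper B := num n

/-- New variables for a tuple of numbers. -/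
def natVars (n : β → ℕ) (b : β) : ListSuper B := num (n b)

variable (L) in
/-- The function `g` to the natural numbers has a definable graph. -/
def DefinableNat (e : X → α → ListSuper B) (g : X → ℕ) : Prop :=
  DefinableAlong (listLang L) (extendAssignment e (Function.const Unit))
    fun c => c.2 = num (g c.1)

theorem definableAlong_holds {n : ℕ} (R : ListRel L n) {g : X → Fin n → ListSuper B}
    (hg : ∀ b, IsVariable e fun c => g c b) :
    DefinableAlong (listLang L) e fun c => holds R (g c) :=
  relMap (K := listLang L) (e := e) R hg

theorem definableAlong_holds_one (R : ListRel L 1) {f : X → ListSuper B} (hf : IsVariable e f) :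
    DefinableAlong (listLang L) e fun c => holds R ![f c] :=
  definableAlong_holds R fun i => by fin_cases i; exact hf

theorem definableAlong_holds_two (R : ListRel L 2) {f g : X → ListSuper B} (hf : IsVariable e f)
    (hg : IsVariable e g) :
    DefinableAlong (listLang L) e fun c => holds R ![f c, g c] :=
  definableAlong_holds R fun i => by fin_cases i <;> assumption

theorem definableAlong_holds_three (R : ListRel L 3) {f g h : X → ListSuper B}
    (hf : IsVariable e f) (hg : IsVariable e g) (hh : IsVariable e h) :
    DefinableAlong (listLang L) e fun c => holds R ![f c, g c, h c] :=
  definableAlong_holds R fun i => by fin_cases i <;> assumption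

theorem definableAlong_subst {g : X → ℕ} (hg : DefinableNat L e g) {P : X → ListSuper B → Prop}
    (hP : DefinableAlong (listLang L)
      (extendAssignment e (Function.const Unit)) fun c => P c.1 c.2) :
    DefinableAlong (listLang L) e fun c => P c (num (g c)) :=
  (ex (P := fun c x => x = num (g c) ∧ P c x) (DefinableAlong.and hg hP)).of_iff fun c => by simp

namespace DefinableNat

theorem weaken {g : X → ℕ} (hg : DefinableNat L e g) {Y : Type*} {f : Y → β → ListSuper B} :
    DefinableNat L (extendAssignment e f) fun c => g c.1 := by
  obtain ⟨φ, h⟩ := hg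
  refine ⟨φ.relabel (Sum.map Sum.inl id), fun c => Formula.realize_relabel.trans ?_⟩
  refine Iff.trans (iff_of_eq (congrArg φ.Realize ?_)) (h (c.1.1, c.2))
  ext (i | i) <;> rfl

theorem of_isVariable {g : X → ℕ} (hg : IsVariable e fun c => num (g c)) : DefinableNat L e g :=
  DefinableAlong.eq IsVariable.new hg.weaken

theorem new : DefinableNat L (extendAssignment e natVar) fun c => c.2 :=
  of_isVariable ⟨.inr (), fun _ => rfl⟩

theorem new_tuple (b : β) : DefinableNat L (extendAssignment e natVars) fun c => c.2 b :=
  of_isVariable ⟨.inr b, fun _ => rfl⟩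

theorem one : DefinableNat L e fun _ => 1 :=
  definableAlong_holds_one .one IsVariable.new

theorem zero : DefinableNat L e fun _ => 0 :=
  definableAlong_holds_one .zero IsVariable.new

theorem add {f g : X → ℕ} (hf : DefinableNat L e f) (hg : DefinableNat L e g) :
    DefinableNat L e fun c => f c + g c := by
  refine (definableAlong_subst (P := fun c x => holds (.add : ListRel L 3) ![x, num (g c.1), c.2])
    hf.weaken <| definableAlong_subst
    (P := fun c x => holds (.add : ListRel L 3) ![c.2, x, c.1.2]) hg.weaken.weaken <|
    definableAlong_holds_three .add IsVariable.new.weaken IsVariable.new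
      IsVariable.new.weaken.weaken).of_iff fun c => ?_
  simp [holds]

theorem mul {f g : X → ℕ} (hf : DefinableNat L e f) (hg : DefinableNat L e g) :
    DefinableNat L e fun c => f c * g c := by
  refine (definableAlong_subst (P := fun c x => holds (.mul : ListRel L 3) ![x, num (g c.1), c.2])
    hf.weaken <| definableAlong_subst
    (P := fun c x => holds (.mul : ListRel L 3) ![c.2, x, c.1.2]) hg.weaken.weaken <|
    definableAlong_holds_three .mul IsVariable.new.weaken IsVariable.new
      IsVariable.new.weaken.weaken).of_iff fun c => ?_
  simp [holds]

theorem eq {f g : X → ℕ} (hf : DefinableNat L e f) (hg : DefinableNat L e g) :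
    DefinableAlong (listLang L) e fun c => f c = g c :=
  (definableAlong_subst (P := fun c x => x = num (g c)) hf hg).of_iff fun c => by simp

end DefinableNat

theorem definableAlong_exists_nat {P : X → ℕ → Prop}
    (h : DefinableAlong (listLang L)
      (extendAssignment e natVar) fun c => P c.1 c.2) :
    DefinableAlong (listLang L) e fun c => ∃ n, P c n := by
  obtain ⟨φ, h⟩ := h
  have h' : DefinableAlong (listLang L) e fun c => ∃ x, holds (.isNum : ListRel L 1) ![x] ∧
      φ.Realize (Sum.elim (e c) fun _ : Unit => x) := by
    refine ex ((definableAlong_holds_one .isNum IsVariable.new).and (realize φ ?_))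
    rintro (i | i)
    · exact ⟨.inl i, fun _ => rfl⟩
    · exact ⟨.inr i, fun _ => rfl⟩
  refine h'.of_iff fun c => ⟨?_, fun ⟨n, hn⟩ => ⟨num n, ⟨n, rfl⟩, (h (c, n)).2 hn⟩⟩
  rintro ⟨_, ⟨n, rfl⟩, hn⟩
  exact ⟨n, (h (c, n)).1 hn⟩

theorem definableAlong_forall_nat {P : X → ℕ → Prop}
    (h : DefinableAlong (listLang L)
      (extendAssignment e natVar) fun c => P c.1 c.2) :
    DefinableAlong (listLang L) e fun c => ∀ n, P c n :=
  (definableAlong_exists_nat (P := fun c x => ¬ P c x) h.not).not.of_iff fun _ => not_exists_not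

theorem definableAlong_exists_nat_tuple [Finite β] {P : X → (β → ℕ) → Prop}
    (h : DefinableAlong (listLang L)
      (extendAssignment e natVars) fun c => P c.1 c.2) :
    DefinableAlong (listLang L) e fun c => ∃ n, P c n := by
  obtain ⟨φ, h⟩ := h
  have h' : DefinableAlong (listLang L) e fun c => ∃ x : β → ListSuper B,
      (∀ b, holds (.isNum : ListRel L 1) ![x b]) ∧ φ.Realize (Sum.elim (e c) x) := by
    refine ex_tuple ((forall_finite fun b => definableAlong_holds_one .isNum
      (IsVariable.new_tuple b)).and (realize φ ?_))
    rintro (i | i)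
    · exact ⟨.inl i, fun _ => rfl⟩
    · exact ⟨.inr i, fun _ => rfl⟩
  refine h'.of_iff fun c =>
    ⟨?_, fun ⟨n, hn⟩ => ⟨fun b => num (n b), fun b => ⟨n b, rfl⟩, (h (c, n)).2 hn⟩⟩
  rintro ⟨x, hx, hn⟩
  choose n hx using hx
  obtain rfl : x = fun b => num (n b) := funext hx
  exact ⟨n, (h (c, n)).1 hn⟩

theorem DefinableNat.eq_num {f : X → ListSuper B} {g : X → ℕ} (hf : IsVariable e f)
    (hg : DefinableNat L e g) : DefinableAlong (listLang L) e fun c => f c = num (g c) :=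
  definableAlong_subst (P := fun c x => f c = x) hg (DefinableAlong.eq hf.weaken IsVariable.new)

theorem DefinableNat.lt {f g : X → ℕ} (hf : DefinableNat L e f) (hg : DefinableNat L e g) :
    DefinableAlong (listLang L) e fun c => f c < g c := by
  refine (definableAlong_exists_nat (P := fun c n => f c + n + 1 = g c) (DefinableNat.eq
    ((hf.weaken.add (.new)).add .one) hg.weaken)).of_iff fun c => ?_
  exact ⟨fun ⟨n, hn⟩ => by omega, fun h => ⟨g c - f c - 1, by omega⟩⟩

theorem definableAlong_comp {s x : X → ListSuper B} {i : X → ℕ} (hs : IsVariable e s)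
    (hx : IsVariable e x) (hi : DefinableNat L e i) :
    DefinableAlong (listLang L) e fun c => holds (.comp : ListRel L 3) ![s c, x c, num (i c)] :=
  definableAlong_subst (P := fun c y => holds (.comp : ListRel L 3) ![s c, x c, y]) hi
    (definableAlong_holds_three .comp hs.weaken hx.weaken IsVariable.new)

theorem definableAlong_len {s : X → ListSuper B} {i : X → ℕ} (hs : IsVariable e s)
    (hi : DefinableNat L e i) :
    DefinableAlong (listLang L) e fun c => holds (.len : ListRel L 2) ![s c, num (i c)] :=
  definableAlong_subst (P := fun c y => holds (.len : ListRel L 2) ![s c, y]) hi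
    (definableAlong_holds_two .len hs.weaken IsVariable.new)

/-! ### Finite sequences in the list superstructure -/

/-- The value at `t` of the sequence of numbers with Gödel code `a`, `b`. -/
def godelValue (a b t : ℕ) : ℕ := a % ((t + 1) * b + 1)

theorem exists_godelValue (m : ℕ) (f : ℕ → ℕ) :
    ∃ a b, ∀ t < m, godelValue a b t = f t := by
  refine ⟨(Nat.unbeta ((List.range m).map f)).unpair.1, (Nat.unbeta ((List.range m).map f)).unpair.2,
    fun t ht => ?_⟩
  simpa [Nat.beta, godelValue] using Nat.beta_unbeta_coe ((List.range m).map f) ⟨t, by simpa using ht⟩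

theorem DefinableNat.godelValue {a b t : X → ℕ} (ha : DefinableNat L e a)
    (hb : DefinableNat L e b) (ht : DefinableNat L e t) :
    DefinableNat L e fun c => godelValue (a c) (b c) (t c) := by
  have hm := ((((ht.weaken (f := Function.const Unit)).weaken (f := natVar)).weaken
    (f := natVar)).add .one |>.mul hb.weaken.weaken.weaken).add .one
  refine (definableAlong_exists_nat (P := fun (c : X × ListSuper B) z => ∃ q, (c.2 = num z ∧
      a c.1 = q * ((t c.1 + 1) * b c.1 + 1) + z) ∧ z < (t c.1 + 1) * b c.1 + 1) <|
    definableAlong_exists_nat (P := fun (c : (X × ListSuper B) × ℕ) q => (c.1.2 = num c.2 ∧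
      a c.1.1 = q * ((t c.1.1 + 1) * b c.1.1 + 1) + c.2) ∧
      c.2 < (t c.1.1 + 1) * b c.1.1 + 1) <|
    ((DefinableNat.eq_num IsVariable.new.weaken.weaken DefinableNat.new.weaken).and <|
    ha.weaken.weaken.weaken.eq ((DefinableNat.new.mul hm).add DefinableNat.new.weaken)).and
    (DefinableNat.new.weaken.lt hm)).of_iff fun c => ?_
  unfold ListSuper.godelValue
  constructor
  · rintro ⟨z, q, ⟨h, h'⟩, h''⟩
    change c.2 = num (a c.1 % _)
    rw [h, h', add_comm, Nat.add_mul_mod_self_right, Nat.mod_eq_of_lt h'']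
  · intro h
    exact ⟨_, _, ⟨h, (Nat.div_add_mod' _ _).symm⟩, Nat.mod_lt _ (Nat.succ_pos _)⟩

end ListSuper

namespace ListSuper

variable {L : FirstOrder.Language.{u, v}} {B : Type w} [L.Structure B] {X : Type*} {α β : Type}
  {e : X → α → ListSuper B}

open DefinableAlong

/-- The element `x` is the one described by the numbers `i` and `l` relative to the list `w`: the
number `i` if `l = 0`, the entry of `w` after the first `i` ones if `l = 1`, and the list of `l - 1`
consecutive entries of `w` after the first `i` ones if `l > 1`. -/
def Decodes (L : FirstOrder.Language.{u, v}) [L.Structure B] (w : ListSuper B) (i l : ℕ)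
    (x : ListSuper B) : Prop :=
  (l = 0 ∧ x = num i) ∨ (l = 1 ∧ holds (.comp : ListRel L 3) ![w, x, num (i + 1)]) ∨
    ∃ n, (l = n + 1 ∧ holds (.len : ListRel L 2) ![x, num n]) ∧ ∀ j, j < n →
      ∃ a, holds (.comp : ListRel L 3) ![x, a, num (j + 1)] ∧
        holds (.comp : ListRel L 3) ![w, a, num (i + j + 1)]

theorem definableAlong_decodes {w x : X → ListSuper B} {i l : X → ℕ} (hw : IsVariable e w)
    (hi : DefinableNat L e i) (hl : DefinableNat L e l) (hx : IsVariable e x) :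
    DefinableAlong (listLang L) e fun c => Decodes L (w c) (i c) (l c) (x c) := by
  refine ((hl.eq .zero).and (DefinableNat.eq_num hx hi)).or <|
    ((hl.eq .one).and (definableAlong_comp hw hx (hi.add .one))).or <|
    definableAlong_exists_nat (P := fun c n => (l c = n + 1 ∧
      holds (.len : ListRel L 2) ![x c, num n]) ∧ ∀ j, j < n →
        ∃ a, holds (.comp : ListRel L 3) ![x c, a, num (j + 1)] ∧
          holds (.comp : ListRel L 3) ![w c, a, num (i c + j + 1)]) <|
    ((hl.weaken.eq (DefinableNat.new.add .one)).and (definableAlong_len hx.weaken .new)).and <|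
    definableAlong_forall_nat (P := fun (c : X × ℕ) j => j < c.2 →
        ∃ a, holds (.comp : ListRel L 3) ![x c.1, a, num (j + 1)] ∧
          holds (.comp : ListRel L 3) ![w c.1, a, num (i c.1 + j + 1)]) <|
    (DefinableNat.new.lt DefinableNat.new.weaken).imp <|
    ex (P := fun (c : (X × ℕ) × ℕ) a => holds (.comp : ListRel L 3) ![x c.1.1, a, num (c.2 + 1)] ∧
          holds (.comp : ListRel L 3) ![w c.1.1, a, num (i c.1.1 + c.2 + 1)]) <|
    (definableAlong_comp hx.weaken.weaken.weaken IsVariable.new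
      (DefinableNat.new.weaken.add .one)).and
    (definableAlong_comp hw.weaken.weaken.weaken IsVariable.new
      ((hi.weaken.weaken.weaken.add DefinableNat.new.weaken).add .one))

/-- The list of the elements of `B` that occur in an element of the list superstructure. -/
def content : ListSuper B → List B
  | elem b => [b]
  | list s => s.1
  | num _ => []

/-- The number that describes, for `Decodes`, the sort and the length. -/
def shape : ListSuper B → ℕ
  | elem _ => 1
  | list s => s.1.length + 1
  | num _ => 0

/-- The number that describes, for `Decodes`, the position, where `i` is the position of the
content. -/
def position (i : ℕ) : ListSuper B → ℕ
  | elem _ => i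
  | list _ => i
  | num n => n

open Classical in
/-- A possibly empty list as an element of the list superstructure. -/
noncomputable def ofList (l : List B) : ListSuper B :=
  if h : l ≠ [] then list ⟨l, h⟩ else num 0

theorem holds_comp_ofList (l : List B) (x : ListSuper B) (i : ℕ) :
    holds (.comp : ListRel L 3) ![ofList l, x, num (i + 1)] ↔ ∃ b, x = elem b ∧ l[i]? = some b := by
  by_cases h : l = [] <;> simp [holds, ofList, h]

theorem holds_comp_list (s : {l : List B // l ≠ []}) (x : ListSuper B) (i : ℕ) :
    holds (.comp : ListRel L 3) ![list s, x, num (i + 1)] ↔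
      ∃ b, x = elem b ∧ s.1[i]? = some b := by
  simp [holds]

theorem exists_concatenation (s : ℕ → List B) (m : ℕ) :
    ∃ (w : List B) (i : ℕ → ℕ), ∀ t < m, ∀ j < (s t).length, w[i t + j]? = (s t)[j]? := by
  induction m with
  | zero => exact ⟨[], 0, by simp⟩
  | succ m ih =>
    obtain ⟨w, i, h⟩ := ih
    refine ⟨w ++ s m, Function.update i m w.length, fun t ht j hj => ?_⟩
    rcases Nat.lt_succ_iff_lt_or_eq.1 ht with ht | rfl
    · rw [Function.update_of_ne ht.ne, List.getElem?_append_left, h t ht j hj]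
      by_contra hlt
      have := h t ht j hj
      rw [List.getElem?_eq_none (not_lt.1 hlt), List.getElem?_eq_getElem hj] at this
      cases this
    · rw [Function.update_self, List.getElem?_append_right (Nat.le_add_right _ _),
        Nat.add_sub_cancel_left]

theorem decodes_iff {w : List B} {i : ℕ} {y : ListSuper B}
    (h : ∀ j < (content y).length, w[i + j]? = (content y)[j]?) (x : ListSuper B) :
    Decodes L (ofList w) (position i y) (shape y) x ↔ x = y := by
  unfold Decodes
  simp only [holds_comp_ofList]
  cases y with
  | num n => simp [position, shape]
  | elem b =>
    have h0 : w[i]? = some b := by simpa [content] using h 0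
    have hlen (n : ℕ) (hn : 1 = n + 1) : ¬ holds (.len : ListRel L 2) ![x, num n] := by
      obtain rfl : n = 0 := by omega
      rintro ⟨s, -, hs⟩
      have : (s.1).length = 0 := by simpa [eq_comm] using hs
      exact s.2 (List.length_eq_zero_iff.1 this)
    simp only [position, shape, one_ne_zero, false_and, false_or, true_and, h0]
    constructor
    · rintro (⟨b', hx, hb⟩ | ⟨n, ⟨hn, hl⟩, -⟩)
      · rw [hx, Option.some_injective _ hb]
      · exact (hlen n hn hl).elim
    · exact fun hx => .inl ⟨b, hx, rfl⟩
  | list s =>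
    have hs : s.1.length ≠ 0 := fun h => s.2 (List.length_eq_zero_iff.1 h)
    simp only [position, shape, content, Nat.add_eq_right, hs, Nat.succ_ne_zero, false_and,
      false_or] at h ⊢
    constructor
    · rintro ⟨n, ⟨hn, s', hx, hl⟩, hc⟩
      obtain rfl : n = s.1.length := by omega
      replace hl : s.1.length = s'.1.length := by simpa using hl
      obtain rfl : x = list s' := hx
      refine congrArg list (Subtype.ext (List.ext_getElem? fun j => ?_))
      by_cases hj : j < s.1.length
      · obtain ⟨a, ha, b, rfl, hb⟩ := hc j hj
        obtain ⟨b', hb', hb''⟩ := (holds_comp_list s' _ j).1 ha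
        cases hb'
        rw [hb'', ← h j hj, hb]
      · rw [List.getElem?_eq_none (not_lt.1 hj), List.getElem?_eq_none (hl ▸ not_lt.1 hj)]
    · rintro rfl
      refine ⟨_, ⟨rfl, s, rfl, rfl⟩, fun j hj => ⟨elem s.1[j], ?_, s.1[j], rfl, ?_⟩⟩
      · exact (holds_comp_list s _ j).2 ⟨_, rfl, List.getElem?_eq_getElem hj⟩
      · rw [h j hj, List.getElem?_eq_getElem hj]

/-- The element `x` is a value at `t` of the sequence that is coded by `w` and `k`. -/
def DecodesAt (L : FirstOrder.Language.{u, v}) [L.Structure B] (w : ListSuper B) (k : Fin 4 → ℕ)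
    (t : ℕ) (x : ListSuper B) : Prop :=
  Decodes L w (godelValue (k 0) (k 1) t) (godelValue (k 2) (k 3) t) x

theorem exists_decodesAt_iff (L : FirstOrder.Language.{u, v}) [L.Structure B]
    (s : ℕ → ListSuper B) (m : ℕ) :
    ∃ (w : ListSuper B) (k : Fin 4 → ℕ), ∀ t < m, ∀ x, DecodesAt L w k t x ↔ x = s t := by
  obtain ⟨w, i, h⟩ := exists_concatenation (fun t => content (s t)) m
  obtain ⟨a, b, hab⟩ := exists_godelValue m fun t => position (i t) (s t)
  obtain ⟨a', b', hab'⟩ := exists_godelValue m fun t => shape (s t)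
  refine ⟨ofList w, ![a, b, a', b'], fun t ht x => ?_⟩
  rw [← decodes_iff (L := L) (h t ht) x, ← hab t ht, ← hab' t ht]
  rfl

theorem definableAlong_decodesAt {w x : X → ListSuper B} {k : X → Fin 4 → ℕ} {t : X → ℕ}
    (hw : IsVariable e w) (hk : ∀ i, DefinableNat L e fun c => k c i) (ht : DefinableNat L e t)
    (hx : IsVariable e x) :
    DefinableAlong (listLang L) e fun c => DecodesAt L (w c) (k c) (t c) (x c) :=
  definableAlong_decodes hw ((hk 0).godelValue (hk 1) ht) ((hk 2).godelValue (hk 3) ht) hx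

end ListSuper

/-! ### Inductively generated relations -/

/-- The least set that is closed under the given rules. -/
inductive Generated {ι : Type*} {m : ι → ℕ} {T : Type*} (R : ∀ i, (Fin (m i) → T) → T → Prop) :
    T → Prop
  | mk (i : ι) (y : Fin (m i) → T) (x : T) (h : R i y x) (hy : ∀ j, Generated R (y j)) :
    Generated R x

/-- The lists in which every entry is obtained by one of the rules from subsequent entries. -/
inductive IsDerivation {ι : Type*} {m : ι → ℕ} {T : Type*}
    (R : ∀ i, (Fin (m i) → T) → T → Prop) : List T → Prop
  | nil : IsDerivation R []
  | cons (i : ι) (y : Fin (m i) → T) (x : T) (l : List T) (h : R i y x) (hy : ∀ j, y j ∈ l)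
    (hl : IsDerivation R l) : IsDerivation R (x :: l)

namespace IsDerivation

variable {ι : Type*} {m : ι → ℕ} {T : Type*} {R : ∀ i, (Fin (m i) → T) → T → Prop}

theorem append {l l' : List T} (h : IsDerivation R l) (h' : IsDerivation R l') :
    IsDerivation R (l ++ l') := by
  induction h with
  | nil => exact h'
  | cons i y x l h hy _ ih => exact cons i y x _ h (fun j => List.mem_append_left _ (hy j)) ih

theorem exists_of_generated {x : T} (h : Generated R x) : ∃ l, IsDerivation R (x :: l) := by
  induction h with
  | mk i y x h _ ih =>
    have key (n : ℕ) (f : Fin n → Fin (m i)) : ∃ l, IsDerivation R l ∧ ∀ j, y (f j) ∈ l := by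
      induction n with
      | zero => exact ⟨[], nil, fun j => j.elim0⟩
      | succ n ihn =>
        obtain ⟨l, hl, hm⟩ := ihn fun j => f j.succ
        obtain ⟨l', hl'⟩ := ih (f 0)
        refine ⟨_, hl'.append hl, fun j => ?_⟩
        cases j using Fin.cases with
        | zero => exact List.mem_append_left _ List.mem_cons_self
        | succ j => exact List.mem_append_right _ (hm j)
    obtain ⟨l, hl, hm⟩ := key _ id
    exact ⟨l, cons i y x l h hm hl⟩

theorem exists_rule {l : List T} (h : IsDerivation R l) (t : ℕ) (ht : t < l.length) :
    ∃ i y, R i y l[t] ∧ ∀ j, ∃ t', ∃ (h : t' < l.length), t < t' ∧ l[t'] = y j := by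
  induction h generalizing t with
  | nil => simp at ht
  | cons i y x l h hy _ ih =>
    cases t with
    | zero =>
      refine ⟨i, y, h, fun j => ?_⟩
      obtain ⟨k, hk, e⟩ := List.mem_iff_getElem.1 (hy j)
      exact ⟨k + 1, by simpa using hk, Nat.succ_pos k, by simpa using e⟩
    | succ t =>
      obtain ⟨i, y, h, hy⟩ := ih t (by simpa using ht)
      refine ⟨i, y, by simpa using h, fun j => ?_⟩
      obtain ⟨k, hk, hlt, e⟩ := hy j
      exact ⟨k + 1, by simpa using hk, by omega, by simpa using e⟩

end IsDerivation

namespace ListSuper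

variable {L : FirstOrder.Language.{u, v}} {B : Type w} [L.Structure B] {X : Type*} {α β : Type}
  {e : X → α → ListSuper B}

open DefinableAlong

theorem generated_iff {ι : Type*} {m : ι → ℕ} [Finite β]
    (R : ∀ i, (Fin (m i) → β → ListSuper B) → (β → ListSuper B) → Prop) (x : β → ListSuper B) :
    Generated R x ↔ ∃ (w : β → ListSuper B) (k : β × Fin 4 → ℕ) (n : ℕ),
      (0 < n ∧ ∀ b, DecodesAt L (w b) (fun i => k (b, i)) 0 (x b)) ∧
      ∀ t, t < n → ∀ z : β → ListSuper B, (∀ b, DecodesAt L (w b) (fun i => k (b, i)) t (z b)) →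
        ∃ i, ∃ y : Fin (m i) × β → ListSuper B, R i (fun j b => y (j, b)) z ∧
          ∀ j, ∃ t', (t < t' ∧ t' < n) ∧
            ∀ b, DecodesAt L (w b) (fun i => k (b, i)) t' (y (j, b)) := by
  constructor
  · intro h
    obtain ⟨l, hl⟩ := IsDerivation.exists_of_generated h
    choose w k hwk using fun b =>
      exists_decodesAt_iff L (fun t => (x :: l).getD t x b) (x :: l).length
    have hdec {t} (ht : t < (x :: l).length) (z : β → ListSuper B) :
        (∀ b, DecodesAt L (w b) (k b) t (z b)) ↔ z = (x :: l)[t] := by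
      rw [funext_iff]
      refine forall_congr' fun b => ?_
      rw [hwk b t ht, List.getD_eq_getElem _ _ ht]
    refine ⟨w, fun b => k b.1 b.2, (x :: l).length, ⟨Nat.succ_pos _, ?_⟩, fun t ht z hz => ?_⟩
    · exact (hdec (Nat.succ_pos _) x).2 rfl
    · obtain rfl := (hdec ht z).1 hz
      obtain ⟨i, y, h, hy⟩ := hl.exists_rule t ht
      refine ⟨i, fun b => y b.1 b.2, h, fun j => ?_⟩
      obtain ⟨t', ht', hlt, e⟩ := hy j
      exact ⟨t', ⟨hlt, ht'⟩, (hdec ht' (y j)).2 e.symm⟩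
  · rintro ⟨w, k, n, ⟨hn, hx⟩, h⟩
    have key (d : ℕ) : ∀ t, t < n → n ≤ t + d → ∀ z : β → ListSuper B,
        (∀ b, DecodesAt L (w b) (fun i => k (b, i)) t (z b)) → Generated R z := by
      induction d with
      | zero => intro t ht hd; omega
      | succ d ih =>
        intro t ht hd z hz
        obtain ⟨i, y, hR, hy⟩ := h t ht z hz
        refine .mk i _ z hR fun j => ?_
        obtain ⟨t', ⟨hlt, ht'⟩, hj⟩ := hy j
        exact ih t' ht' (by omega) _ hj
    exact key n 0 hn (by omega) x hx

theorem exists_formula_generated [Finite β] {ι : Type*} [Finite ι] {m : ι → ℕ} {γ : Type}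
    (ρ : ∀ i, (listLang L).Formula (((Fin (m i) × β) ⊕ β) ⊕ γ)) :
    ∃ σ : (listLang L).Formula (β ⊕ γ), ∀ (x : β → ListSuper B) (c : γ → ListSuper B),
      σ.Realize (Sum.elim x c) ↔ Generated
        (fun i (y : Fin (m i) → β → ListSuper B) x => (ρ i).Realize (Sum.elim (Sum.elim (fun b => y b.1 b.2) x) c)) x := by
  suffices h : DefinableAlong (listLang L) (extendAssignment (X := β → ListSuper B)
      (Y := γ → ListSuper B) id id) fun c => Generated
        (fun i (y : Fin (m i) → β → ListSuper B) x => (ρ i).Realize (Sum.elim (Sum.elim (fun b => y b.1 b.2) x) c.2)) c.1 by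
    obtain ⟨σ, h⟩ := h
    exact ⟨σ, fun x c => h (x, c)⟩
  have hx (b : β) : IsVariable (extendAssignment (X := β → ListSuper B)
      (Y := γ → ListSuper B) id id) fun c => c.1 b := ⟨.inl b, fun _ => rfl⟩
  have hc (g : γ) : IsVariable (extendAssignment (X := β → ListSuper B)
      (Y := γ → ListSuper B) id id) fun c => c.2 g := ⟨.inr g, fun _ => rfl⟩
  simp only [generated_iff (L := L)]
  refine ex_tuple <| definableAlong_exists_nat_tuple <| definableAlong_exists_nat ?_
  have hw (b : β) := (((IsVariable.new_tuple (e := extendAssignment (X := β → ListSuper B)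
    (Y := γ → ListSuper B) id id) b).weaken (f := natVars (β := β × Fin 4))).weaken (f := natVar))
  have hk (b : β) (i : Fin 4) := (DefinableNat.new_tuple (L := L) (e := extendAssignment
    (extendAssignment (X := β → ListSuper B) (Y := γ → ListSuper B) id id)
    (id : (β → ListSuper B) → _)) (b, i)).weaken (f := natVar)
  refine and (and (DefinableNat.zero.lt .new) ?_) ?_
  · exact forall_finite fun b => definableAlong_decodesAt (hw b) (hk b) .zero
      (hx b).weaken.weaken.weaken
  refine definableAlong_forall_nat <| (DefinableNat.new.lt DefinableNat.new.weaken).imp <|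
    all_tuple <| imp ?_ ?_
  · exact forall_finite fun b => definableAlong_decodesAt (hw b).weaken.weaken
      (fun i => (hk b i).weaken.weaken) DefinableNat.new.weaken (.new_tuple b)
  refine exists_finite fun i => ex_tuple <| and ?_ ?_
  · refine realize (ρ i) ?_
    rintro ((b | b) | g)
    · exact .new_tuple b
    · exact (IsVariable.new_tuple b).weaken
    · exact (hc g).weaken.weaken.weaken.weaken.weaken.weaken
  · refine forall_finite fun j => definableAlong_exists_nat <|
      and (and (DefinableNat.new.weaken.weaken.weaken.lt .new)
        (DefinableNat.new.lt DefinableNat.new.weaken.weaken.weaken.weaken)) ?_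
    exact forall_finite fun b => definableAlong_decodesAt (hw b).weaken.weaken.weaken.weaken
      (fun i => (hk b i).weaken.weaken.weaken.weaken) .new (IsVariable.new_tuple (j, b)).weaken

end ListSuper

/-! ### Definability of isomorphisms that are definable on a copy of `B` -/

namespace InterpCode

section IsoRule

variable {L : FirstOrder.Language.{u, v}} {K : FirstOrder.Language.{u', v'}}
  {Γ₁ Γ₂ : InterpCode L K} {M : Type w} [K.Structure M] {κ : Type}

variable (L) in
/-- The number of premises of the rules in `isoRule`. -/
def isoRuleArity (κ : Type) : Unit ⊕ κ ⊕ (Σ m, L.Functions m) → ℕ :=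
  Sum.elim (fun _ => 0) (Sum.elim (fun _ => 0) Sigma.fst)

/-- Rules that generate the graph of an isomorphism from `Γ₁(M, p₁)` to `Γ₂(M, p₂)`: the graph
contains the relation `T`, the pairs `g j` up to equivalence, and is closed under the operations. -/
def isoRule (p₁ : Fin Γ₁.pdim → M) (p₂ : Fin Γ₂.pdim → M)
    (T : (Fin Γ₁.dim ⊕ Fin Γ₂.dim → M) → Prop) (g : κ → Fin Γ₁.dim ⊕ Fin Γ₂.dim → M) :
    ∀ i, (Fin (isoRuleArity L κ i) → Fin Γ₁.dim ⊕ Fin Γ₂.dim → M) →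
      (Fin Γ₁.dim ⊕ Fin Γ₂.dim → M) → Prop
  | .inl _, _, z => T z
  | .inr (.inl j), _, z => Γ₁.Eqv M p₁ (fun i => g j (.inl i)) (fun i => z (.inl i)) ∧
      Γ₂.Eqv M p₂ (fun i => g j (.inr i)) (fun i => z (.inr i))
  | .inr (.inr f), y, z => Γ₁.Graph M p₁ f.2 (fun j i => y j (.inl i)) (fun i => z (.inl i)) ∧
      Γ₂.Graph M p₂ f.2 (fun j i => y j (.inr i)) (fun i => z (.inr i))

theorem jointlyDefinable_isoRule {N : Type w'} [K.Structure N] {α γ : Type}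
    (θ : K.Formula ((Fin Γ₁.dim ⊕ Fin Γ₂.dim) ⊕ γ)) (p₁ : Fin Γ₁.pdim → α) (p₂ : Fin Γ₂.pdim → α)
    (c : γ → α) (g : κ → Fin Γ₁.dim ⊕ Fin Γ₂.dim → α) (i : Unit ⊕ κ ⊕ (Σ m, L.Functions m))
    (y : Fin (isoRuleArity L κ i) → Fin Γ₁.dim ⊕ Fin Γ₂.dim → α)
    (z : Fin Γ₁.dim ⊕ Fin Γ₂.dim → α) :
    JointlyDefinable K
      (fun v : α → M => isoRule (fun i => v (p₁ i)) (fun i => v (p₂ i))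
        (fun z => θ.Realize (Sum.elim z fun i => v (c i))) (fun j b => v (g j b)) i
        (fun j b => v (y j b)) fun b => v (z b))
      (fun v : α → N => isoRule (fun i => v (p₁ i)) (fun i => v (p₂ i))
        (fun z => θ.Realize (Sum.elim z fun i => v (c i))) (fun j b => v (g j b)) i
        (fun j b => v (y j b)) fun b => v (z b)) := by
  rcases i with i | j | f
  · refine (JointlyDefinable.realize θ (Sum.elim z c)).of_iff (fun v => ?_) fun v => ?_ <;>
    · refine iff_of_eq (congrArg θ.Realize ?_)
      ext (b | b) <;> rfl
  · exact (Γ₁.jointlyDefinable_eqv _ _ _).and (Γ₂.jointlyDefinable_eqv _ _ _)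
  · exact (Γ₁.jointlyDefinable_graph f.2 _ _ _).and (Γ₂.jointlyDefinable_graph f.2 _ _ _)

variable {p₁ : Fin Γ₁.pdim → M} {p₂ : Fin Γ₂.pdim → M} {h₁ : Γ₁.Admissible M p₁}
  {h₂ : Γ₂.Admissible M p₂} {A : Type w'} [L.Structure A]

theorem generated_isoRule_iff {B : L.Substructure A} (e : Str h₁ ≃[L] A) (ψ : Str h₁ ≃[L] Str h₂)
    {g : κ → Fin Γ₁.dim ⊕ Fin Γ₂.dim → M} (hg₁ : ∀ j, Γ₁.InDom M p₁ fun i => g j (.inl i))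
    (hg₂ : ∀ j, Γ₂.InDom M p₂ fun i => g j (.inr i))
    (hg : ∀ j, ψ (cls h₁ _ (hg₁ j)) = cls h₂ _ (hg₂ j))
    (hB : Substructure.closure L ((B : Set A) ∪ Set.range fun j => e (cls h₁ _ (hg₁ j))) = ⊤)
    (z : Fin Γ₁.dim ⊕ Fin Γ₂.dim → M) :
    Generated (isoRule p₁ p₂ (· ∈ restrictedGraph B e ψ) g) z ↔
      ∃ hx hy, ψ (cls h₁ (fun i => z (.inl i)) hx) = cls h₂ (fun i => z (.inr i)) hy := by
  constructor
  · intro hz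
    induction hz with
    | mk i y z hR _ ih =>
      rcases i with i | j | f
      · obtain ⟨hx, hy, -, h⟩ := hR
        exact ⟨hx, hy, h⟩
      · obtain ⟨hR₁, hR₂⟩ := hR
        refine ⟨(h₁.eqv_dom _ _ hR₁).2, (h₂.eqv_dom _ _ hR₂).2, ?_⟩
        rw [← (cls_eq_iff h₁ _ _ (hg₁ j) _).2 hR₁, ← (cls_eq_iff h₂ _ _ (hg₂ j) _).2 hR₂, hg]
      · obtain ⟨hR₁, hR₂⟩ := hR
        choose hx hy ih using ih
        refine ⟨(h₁.graph_dom _ _ _ hR₁).2, (h₂.graph_dom _ _ _ hR₂).2, ?_⟩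
        rw [← (funMap_cls_iff h₁ f.2 _ hx _ _).2 hR₁, ← (funMap_cls_iff h₂ f.2 _ hy _ _).2 hR₂,
          ψ.map_fun]
        exact congrArg _ (funext ih)
  · rintro ⟨hx, hy, hψ⟩
    have key (a : A) : ∀ (z : Fin Γ₁.dim ⊕ Fin Γ₂.dim → M)
        (hx : Γ₁.InDom M p₁ fun i => z (.inl i)) (hy : Γ₂.InDom M p₂ fun i => z (.inr i)),
        e (cls h₁ _ hx) = a → ψ (cls h₁ _ hx) = cls h₂ _ hy →
          Generated (isoRule p₁ p₂ (· ∈ restrictedGraph B e ψ) g) z := by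
      refine Substructure.closure_induction (p := fun a => ∀ (z : Fin Γ₁.dim ⊕ Fin Γ₂.dim → M)
        (hx : Γ₁.InDom M p₁ fun i => z (.inl i)) (hy : Γ₂.InDom M p₂ fun i => z (.inr i)),
        e (cls h₁ _ hx) = a → ψ (cls h₁ _ hx) = cls h₂ _ hy →
          Generated (isoRule p₁ p₂ (· ∈ restrictedGraph B e ψ) g) z)
        (hB ▸ Substructure.mem_top a) (fun a ha => ?_) fun {n} f a ih => ?_
      · intro z hx hy hea hψ
        rcases ha with ha | ⟨j, rfl⟩
        · subst hea
          exact .mk (R := isoRule p₁ p₂ (· ∈ restrictedGraph B e ψ) g) (.inl ())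
            (fun j => Fin.elim0 j) z ⟨hx, hy, ha, hψ⟩ fun j => Fin.elim0 j
        · refine .mk (R := isoRule p₁ p₂ (· ∈ restrictedGraph B e ψ) g) (.inr (.inl j))
            (fun j => Fin.elim0 j) z ⟨?_, ?_⟩ fun j => Fin.elim0 j
          · exact (cls_eq_iff h₁ _ _ (hg₁ j) hx).1 (e.injective hea.symm)
          · rw [← cls_eq_iff h₂ _ _ (hg₂ j) hy, ← hg, ← hψ, e.injective hea.symm]
      · intro z hx hy hea hψ
        obtain ⟨x, hx', ex⟩ := exists_cls_family fun i => e.symm (a i)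
        obtain ⟨y, hy', ey⟩ := exists_cls_family fun i => ψ (e.symm (a i))
        have hz : Structure.funMap f (fun i => cls h₁ (x i) (hx' i)) = cls h₁ _ hx := by
          rw [ex]
          apply e.injective
          rw [hea, e.map_fun]
          exact congrArg _ (funext fun i => e.apply_symm_apply (a i))
        refine .mk (R := isoRule p₁ p₂ (· ∈ restrictedGraph B e ψ) g) (.inr (.inr ⟨n, f⟩))
          (fun j => Sum.elim (x j) (y j)) z ⟨?_, ?_⟩ fun j => ?_
        · exact (funMap_cls_iff h₁ f x hx' _ hx).1 hz
        · refine (funMap_cls_iff h₂ f y hy' _ hy).1 ?_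
          rw [← hψ, ← hz, ψ.map_fun, ex, ey]
          rfl
        · refine ih j _ (hx' j) (hy' j) ?_ ?_
          · exact (congrArg e (congrFun ex j)).trans (e.apply_symm_apply _)
          · exact (congrArg ψ (congrFun ex j)).trans (congrFun ey j).symm
    exact key _ z hx hy rfl hψ

end IsoRule

variable {L : FirstOrder.Language.{u, v}} [Finite L.Symbols]

/-- If `A` is finitely generated over `B`, then an isomorphism between two interpretations of `A`
in the list superstructure is definable if it is definable on a copy of `B`, uniformly in the
parameters. -/
theorem exists_formula_isIsoGraph {A : Type w} [L.Structure A] (B : L.Substructure A)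
    (hfg : ∃ X : Finset A, Substructure.closure L ((B : Set A) ∪ (X : Set A)) = ⊤)
    (Γ₁ Γ₂ : InterpCode L (listLang L)) {δ : Type} [Finite δ]
    (θ : (listLang L).Formula
      ((Fin Γ₁.dim ⊕ Fin Γ₂.dim) ⊕ (Fin Γ₁.pdim ⊕ (Fin Γ₂.pdim ⊕ δ)))) :
    ∃ (γ : Type) (_ : Finite γ) (σ : (listLang L).Formula ((Fin Γ₁.dim ⊕ Fin Γ₂.dim) ⊕ γ)),
      ∀ (p₁ : Fin Γ₁.pdim → ListSuper B) (p₂ : Fin Γ₂.pdim → ListSuper B) (c : δ → ListSuper B)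
        (h₁ : Γ₁.Admissible (ListSuper B) p₁) (h₂ : Γ₂.Admissible (ListSuper B) p₂)
        (e : Str h₁ ≃[L] A) (ψ : Str h₁ ≃[L] Str h₂),
        restrictedGraph B e ψ = {z | θ.Realize (Sum.elim z (Sum.elim p₁ (Sum.elim p₂ c)))} →
        ∃ d : γ → ListSuper B, IsIsoGraph Γ₁ Γ₂ p₁ p₂
          fun x y => σ.Realize (Sum.elim (Sum.elim x y) d) := by
  obtain ⟨X, hX⟩ := hfg
  have := finite_functions (L := L)
  choose ρ hρ _ using fun i : Unit ⊕ Fin X.card ⊕ (Σ m, L.Functions m) =>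
    jointlyDefinable_isoRule (M := ListSuper B) (N := ListSuper B)
    (α := ((Fin (isoRuleArity L _ i) × (Fin Γ₁.dim ⊕ Fin Γ₂.dim)) ⊕ (Fin Γ₁.dim ⊕ Fin Γ₂.dim)) ⊕
      ((Fin Γ₁.pdim ⊕ (Fin Γ₂.pdim ⊕ δ)) ⊕ (Fin X.card × (Fin Γ₁.dim ⊕ Fin Γ₂.dim)))) θ (fun i => .inr (.inl (.inl i)))
    (fun i => .inr (.inl (.inr (.inl i)))) (fun i => .inr (.inl i)) (fun j b => .inr (.inr (j, b))) i
    (fun j b => .inl (.inl (j, b))) fun b => .inl (.inr b)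
  obtain ⟨σ, hσ⟩ := ListSuper.exists_formula_generated (B := B) ρ
  refine ⟨_, inferInstance, σ, fun p₁ p₂ c h₁ h₂ e ψ hθ => ?_⟩
  obtain ⟨x, hx, ex⟩ := exists_cls_family fun j => e.symm (X.equivFin.symm j : A)
  obtain ⟨y, hy, ey⟩ := exists_cls_family fun j => ψ (e.symm (X.equivFin.symm j : A))
  have hX' : (X : Set A) = Set.range fun j => e (cls h₁ (x j) (hx j)) := by
    have : (fun j => e (cls h₁ (x j) (hx j))) = fun j => (X.equivFin.symm j : A) :=
      funext fun j => (congrArg e (congrFun ex j)).trans (e.apply_symm_apply _)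
    rw [this]
    ext a
    exact ⟨fun ha => ⟨X.equivFin ⟨a, ha⟩, by simp⟩, fun ⟨j, hj⟩ => hj ▸ (X.equivFin.symm j).2⟩
  refine ⟨Sum.elim (Sum.elim p₁ (Sum.elim p₂ c)) fun j => Sum.elim (x j.1) (y j.1) j.2, ?_⟩
  convert isIsoGraph_of_equiv ψ using 3 with x' y'
  rw [hσ]
  refine Iff.trans ?_ (generated_isoRule_iff (g := fun j => Sum.elim (x j) (y j)) e ψ hx hy
    (fun j => (congrArg ψ (congrFun ex j)).trans (congrFun ey j).symm) (by rw [← hX, hX']; rfl)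
    (Sum.elim x' y'))
  rw [hθ]
  simp only [hρ]
  rfl

/-- A formula that defines, with all admitted parameters `p₁`, `p₂` and suitable additional
parameters, an isomorphism in `M`, does so in all structures elementarily equivalent to `M`. -/
theorem transfer_isIsoGraph {K : FirstOrder.Language.{u', v'}} {M : Type w} {N : Type w'}
    [K.Structure M] [K.Structure N] (hMN : K.ElementarilyEquivalent M N) {Γ₁ Γ₂ : InterpCode L K}
    (φ₁ : K.Formula (Fin Γ₁.pdim)) (φ₂ : K.Formula (Fin Γ₂.pdim)) {γ : Type} [Finite γ]
    (σ : K.Formula ((Fin Γ₁.dim ⊕ Fin Γ₂.dim) ⊕ γ)) :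
    (∀ p₁ : Fin Γ₁.pdim → M, φ₁.Realize p₁ → ∀ p₂ : Fin Γ₂.pdim → M, φ₂.Realize p₂ →
      ∃ d : γ → M, IsIsoGraph Γ₁ Γ₂ p₁ p₂ fun x y => σ.Realize (Sum.elim (Sum.elim x y) d)) ↔
    (∀ p₁ : Fin Γ₁.pdim → N, φ₁.Realize p₁ → ∀ p₂ : Fin Γ₂.pdim → N, φ₂.Realize p₂ →
      ∃ d : γ → N, IsIsoGraph Γ₁ Γ₂ p₁ p₂ fun x y => σ.Realize (Sum.elim (Sum.elim x y) d)) :=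
  JointlyDefinable.transfer hMN <| .all <| .imp (.realize φ₁ _) <| .all <| .imp (.realize φ₂ _) <| .ex <|
    jointlyDefinable_isIsoGraph Γ₁ Γ₂ σ _ _ _

theorem transfer_exists_isIsoGraph {K : FirstOrder.Language.{u', v'}} {M : Type w} {N : Type w'}
    [K.Structure M] [K.Structure N] (hMN : K.ElementarilyEquivalent M N) {Γ₁ Γ₂ : InterpCode L K}
    (φ₁ : K.Formula (Fin Γ₁.pdim)) (φ₂ : K.Formula (Fin Γ₂.pdim)) {γ : Type} [Finite γ]
    (σ : K.Formula ((Fin Γ₁.dim ⊕ Fin Γ₂.dim) ⊕ γ)) :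
    (∃ (p₁ : Fin Γ₁.pdim → M) (p₂ : Fin Γ₂.pdim → M), φ₁.Realize p₁ ∧ φ₂.Realize p₂ ∧
      Γ₁.Admissible M p₁ ∧ Γ₂.Admissible M p₂ ∧
      ∃ d : γ → M, IsIsoGraph Γ₁ Γ₂ p₁ p₂ fun x y => σ.Realize (Sum.elim (Sum.elim x y) d)) ↔
    (∃ (p₁ : Fin Γ₁.pdim → N) (p₂ : Fin Γ₂.pdim → N), φ₁.Realize p₁ ∧ φ₂.Realize p₂ ∧
      Γ₁.Admissible N p₁ ∧ Γ₂.Admissible N p₂ ∧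
      ∃ d : γ → N, IsIsoGraph Γ₁ Γ₂ p₁ p₂ fun x y => σ.Realize (Sum.elim (Sum.elim x y) d)) :=
  JointlyDefinable.transfer hMN <| .ex <| .ex <| .and (.realize φ₁ _) <| .and (.realize φ₂ _) <|
    .and (Γ₁.jointlyDefinable_admissible _) <| .and (Γ₂.jointlyDefinable_admissible _) <| .ex <|
    jointlyDefinable_isIsoGraph Γ₁ Γ₂ σ _ _ _

theorem IsRegularInterp.transfer {K : FirstOrder.Language.{u', v'}} {M N : Type*}
    [K.Structure M] [K.Structure N] (hMN : K.ElementarilyEquivalent M N) {Γ : InterpCode L K}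
    {φ : K.Formula (Fin Γ.pdim)} {A : Type*} [L.Structure A] (h : Γ.IsRegularInterp N φ A) :
    (∃ q : Fin Γ.pdim → M, φ.Realize q) ∧ ∀ q : Fin Γ.pdim → M, φ.Realize q → Γ.Admissible M q := by
  constructor
  · exact (JointlyDefinable.transfer hMN <| .ex <| .realize φ _).2 h.1
  · exact (JointlyDefinable.transfer hMN <| .all <| .imp (.realize φ _) <|
      Γ.jointlyDefinable_admissible _).2 fun p hp => (h.2 p hp).1

/-- A set that is definable with parameters is defined by a formula with a finite tuple of
parameters. -/
theorem exists_formula_of_definable {K : FirstOrder.Language.{u', v'}} {M : Type w} [K.Structure M]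
    {α : Type} {A : Set M} {s : Set (α → M)} (h : A.Definable K s) :
    ∃ (r : ℕ) (θ : K.Formula (α ⊕ Fin r)) (c : Fin r → M), s = {z | θ.Realize (Sum.elim z c)} := by
  obtain ⟨A₀, -, h⟩ := Set.definable_iff_finitely_definable.1 h
  obtain ⟨φ, rfl⟩ := Set.definable_iff_exists_formula_sum.1 h
  refine ⟨A₀.card, φ.relabel (Sum.elim (fun a => .inr (A₀.equivFin a)) .inl),
    fun i => A₀.equivFin.symm i, ?_⟩
  ext z
  rw [Set.mem_ofPred_eq, Set.mem_ofPred_eq, Formula.realize_relabel]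
  refine iff_of_eq (congrArg φ.Realize ?_)
  ext (a | a)
  · simp
  · rfl

end InterpCode

theorem mainTheorem8 {L : FirstOrder.Language.{u, v}} [Finite L.Symbols]
    {A : Type w} [L.Structure A] (B : L.Substructure A)
    (hB : (Set.univ : Set A).Definable₁ L (B : Set A))
    (hfg : ∃ X : Finset A, Substructure.closure L ((B : Set A) ∪ (X : Set A)) = ⊤)
    (Γ₁ Γ₂ : InterpCode L (listLang L))
    (φ₁ : (listLang L).Formula (Fin Γ₁.pdim)) (φ₂ : (listLang L).Formula (Fin Γ₂.pdim))
    (hΓ₁ : Γ₁.IsRegularInterp (ListSuper B) φ₁ A)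
    (hΓ₂ : Γ₂.IsRegularInterp (ListSuper B) φ₂ A)
    {M : Type w'} [(listLang L).Structure M]
    (hM : (listLang L).ElementarilyEquivalent M (ListSuper B)) :
    -- an isomorphism for all admitted parameters, uniformly definable on the copy of `B`
    ((∃ (r : ℕ) (θ : (listLang L).Formula ((Fin Γ₁.dim ⊕ Fin Γ₂.dim) ⊕
          (Fin Γ₁.pdim ⊕ (Fin Γ₂.pdim ⊕ Fin r)))),
        ∀ (p₁ : Fin Γ₁.pdim → ListSuper B) (p₂ : Fin Γ₂.pdim → ListSuper B),
          φ₁.Realize p₁ → φ₂.Realize p₂ →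
          ∃ (c : Fin r → ListSuper B)
            (h₁ : Γ₁.Admissible (ListSuper B) p₁) (h₂ : Γ₂.Admissible (ListSuper B) p₂)
            (e : InterpCode.Str h₁ ≃[L] A) (ψ : InterpCode.Str h₁ ≃[L] InterpCode.Str h₂),
            InterpCode.restrictedGraph B e ψ =
              {z | θ.Realize (Sum.elim z (Sum.elim p₁ (Sum.elim p₂ c)))}) →
      Γ₁.WellDefined M φ₁ ∧ Γ₂.WellDefined M φ₂ ∧
        ∀ (q₁ : Fin Γ₁.pdim → M) (q₂ : Fin Γ₂.pdim → M)
          (h₁ : Γ₁.Admissible M q₁) (h₂ : Γ₂.Admissible M q₂),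
          φ₁.Realize q₁ → φ₂.Realize q₂ →
            Nonempty (InterpCode.Str h₁ ≃[L] InterpCode.Str h₂)) ∧
    -- an isomorphism for one choice of parameters, definable on the copy of `B`
    ((∃ (p₁ : Fin Γ₁.pdim → ListSuper B) (p₂ : Fin Γ₂.pdim → ListSuper B)
        (h₁ : Γ₁.Admissible (ListSuper B) p₁) (h₂ : Γ₂.Admissible (ListSuper B) p₂)
        (e : InterpCode.Str h₁ ≃[L] A) (ψ : InterpCode.Str h₁ ≃[L] InterpCode.Str h₂),
        φ₁.Realize p₁ ∧ φ₂.Realize p₂ ∧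
          (Set.univ : Set (ListSuper B)).Definable (listLang L)
            (InterpCode.restrictedGraph B e ψ)) →
      (∃ (q₁ : Fin Γ₁.pdim → M) (q₂ : Fin Γ₂.pdim → M)
        (h₁ : Γ₁.Admissible M q₁) (h₂ : Γ₂.Admissible M q₂),
        φ₁.Realize q₁ ∧ φ₂.Realize q₂ ∧
          Nonempty (InterpCode.Str h₁ ≃[L] InterpCode.Str h₂)) ∧
      (Γ₁.WellDefined M φ₁ → Γ₂.WellDefined M φ₂ →
        ∀ (q₁ : Fin Γ₁.pdim → M) (q₂ : Fin Γ₂.pdim → M)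
          (h₁ : Γ₁.Admissible M q₁) (h₂ : Γ₂.Admissible M q₂),
          φ₁.Realize q₁ → φ₂.Realize q₂ →
            Nonempty (InterpCode.Str h₁ ≃[L] InterpCode.Str h₂))) := by
  constructor
  · rintro ⟨r, θ, hθ⟩
    obtain ⟨γ, _, σ, hσ⟩ := InterpCode.exists_formula_isIsoGraph B hfg Γ₁ Γ₂ θ
    have hiso := (InterpCode.transfer_isIsoGraph hM φ₁ φ₂ σ).2 fun p₁ hp₁ p₂ hp₂ => by
      obtain ⟨c, h₁, h₂, e, ψ, h⟩ := hθ p₁ p₂ hp₁ hp₂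
      exact hσ p₁ p₂ c h₁ h₂ e ψ h
    have hiso' (q₁ : Fin Γ₁.pdim → M) (q₂ : Fin Γ₂.pdim → M) (h₁ : Γ₁.Admissible M q₁)
        (h₂ : Γ₂.Admissible M q₂) (hq₁ : φ₁.Realize q₁) (hq₂ : φ₂.Realize q₂) :
        Nonempty (InterpCode.Str h₁ ≃[L] InterpCode.Str h₂) := by
      obtain ⟨d, hd⟩ := hiso q₁ hq₁ q₂ hq₂
      exact hd.nonempty_equiv h₁ h₂
    obtain ⟨⟨q₁, hq₁⟩, hadm₁⟩ := hΓ₁.transfer hM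
    obtain ⟨⟨q₂, hq₂⟩, hadm₂⟩ := hΓ₂.transfer hM
    refine ⟨⟨⟨q₁, hq₁⟩, hadm₁, fun q q' h h' hq hq' => ?_⟩,
      ⟨⟨q₂, hq₂⟩, hadm₂, fun q q' h h' hq hq' => ?_⟩, hiso'⟩
    · obtain ⟨f⟩ := hiso' q q₂ h (hadm₂ q₂ hq₂) hq hq₂
      obtain ⟨f'⟩ := hiso' q' q₂ h' (hadm₂ q₂ hq₂) hq' hq₂
      exact ⟨f'.symm.comp f⟩
    · obtain ⟨f⟩ := hiso' q₁ q (hadm₁ q₁ hq₁) h hq₁ hq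
      obtain ⟨f'⟩ := hiso' q₁ q' (hadm₁ q₁ hq₁) h' hq₁ hq'
      exact ⟨f'.comp f.symm⟩
  · rintro ⟨p₁, p₂, h₁, h₂, e, ψ, hp₁, hp₂, hdef⟩
    obtain ⟨r, θ, c, hθ⟩ := InterpCode.exists_formula_of_definable hdef
    obtain ⟨γ, _, σ, hσ⟩ := InterpCode.exists_formula_isIsoGraph B hfg Γ₁ Γ₂
      (θ.relabel (Sum.map id fun i => .inr (.inr i)))
    obtain ⟨q₁, q₂, hq₁, hq₂, h₁', h₂', d, hd⟩ :=
      (InterpCode.transfer_exists_isIsoGraph hM φ₁ φ₂ σ).2 ⟨p₁, p₂, hp₁, hp₂, h₁, h₂,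
        hσ p₁ p₂ c h₁ h₂ e ψ <| hθ.trans <| by
          ext z
          rw [Set.mem_ofPred_eq, Set.mem_ofPred_eq, Formula.realize_relabel]
          refine iff_of_eq (congrArg θ.Realize ?_)
          ext (i | i) <;> rfl⟩
    obtain ⟨f⟩ := hd.nonempty_equiv h₁' h₂'
    refine ⟨⟨q₁, q₂, h₁', h₂', hq₁, hq₂, ⟨f⟩⟩, fun hw₁ hw₂ s₁ s₂ k₁ k₂ hs₁ hs₂ => ?_⟩
    obtain ⟨f₁⟩ := hw₁.2.2 s₁ q₁ k₁ h₁' hs₁ hq₁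
    obtain ⟨f₂⟩ := hw₂.2.2 q₂ s₂ h₂' k₂ hq₂ hs₂
    exact ⟨f₂.comp (f.comp f₁)⟩
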